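/- **Theorem 4.7 (ADMM / Douglas–Rachford with infimal postcompositions).** Let $\mathcal X,\mathcal Y,\mathcal U$ be real Hilbert spaces, let $f:\mathcal X\to\mathbb R\cup\{+\infty\}$ and $g:\mathcal Y\to\mathbb R\cup\{+\infty\}$ be convex, proper and lower semicontinuous, let $L:\mathcal X\to\mathcal U$ and $K:\mathcal Y\to\mathcal U$ be nonzero bounded linear operators, and let $c\in\mathcal U$. Consider the primal problem $$\text{(P)}\qquad \min_{(x,y)\in\mathcal X\times\mathcal Y} f(x)+g(y)\quad\text{s.t.}\quad Lx+Ky=c,$$ the dual problem $$\text{(D)}\qquad \min_{u\in\mathcal U} f^*(-L^*u)+g^*(-K^*u)+\langle u,c\rangle,$$ where $f^*,g^*$ are the Fenchel conjugates and $L^*,K^*$ the adjoints, and the reformulated problem $$\text{(R)}\qquad \min_{r\in\mathcal U}\ (L\triangleright f)(r)+((-K)\triangleright g)(r-c),$$ where $(L\triangleright f)(r)=\inf\{f(x): x\in\mathcal X,\ Lx=r\}$ and $((-K)\triangleright g)(r)=\inf\{g(y): y\in\mathcal Y,\ -Ky=r\}$ (with $\inf\emptyset=+\infty$). Assume that 1.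 there is $(x,y,u)\in\mathcal X\times\mathcal Y\times\mathcal U$ with $0\in\partial f(x)+L^*u$, $0\in\partial g(y)+K^*u$ and $Lx+Ky=c$; 2. both infimal postcompositions are exact: for every $r\in\operatorname{ran}L$, $f$ attains its minimum over $\{x: Lx=r\}$, and for every $r\in\operatorname{ran}K$, $g$ attains its minimum over $\{y: -Ky=r\}$; 3. $L\triangleright f$ and $(-K)\triangleright g$ are lower semicontinuous. Let $\tau>0$, let $(\rho^{(i)})_{i\in\mathbb N}$ be a sequence in $[0,2]$ with $\sum_{i\in\mathbb N}\rho^{(i)}(2-\rho^{(i)})=+\infty$, and let $y^{(0)}\in\mathcal Y$, $\tilde v^{(0)},s^{(0)}\in\mathcal U$ satisfy $s^{(0)}=-Ky^{(0)}+c-\tilde v^{(0)}$. Consider the ADMM iteration, for $i=0,1,\ldots$, $$\begin{aligned} x^{(i+\frac12)}&\in\operatorname*{argmin}_{x\in\mathcal X}\ \tau f(x)+\tfrac12\|Lx+Ky^{(i)}-c+\tilde v^{(i)}\|^2,\\ \tilde v^{(i+\frac12)}&=\tilde v^{(i)}+Lx^{(i+\frac12)}+Ky^{(i)}-c,\\ y^{(i+1)}&\in\operatorname*{argmin}_{y\in\mathcal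 Y}\ \tau g(y)+\tfrac12\|Lx^{(i+\frac12)}+Ky-c+\tilde v^{(i+\frac12)}\|^2,\\ \tilde v^{(i+1)}&=\tilde v^{(i+\frac12)}+(\rho^{(i)}-1)\big(Lx^{(i+\frac12)}+Ky^{(i+1)}-c\big), \end{aligned}$$ and the Douglas–Rachford iteration, for $i=0,1,\ldots$, $$\begin{aligned} x^{(i+\frac12)}&\in\operatorname*{argmin}_{x\in\mathcal X}\ \tau f(x)+\tfrac12\|Lx-s^{(i)}\|^2,\\ y^{(i+1)}&\in\operatorname*{argmin}_{y\in\mathcal Y}\ \tau g(y)+\tfrac12\|Ky-c+2Lx^{(i+\frac12)}-s^{(i)}\|^2,\\ s^{(i+1)}&=s^{(i)}-\rho^{(i)}\big(Lx^{(i+\frac12)}+Ky^{(i+1)}-c\big). \end{aligned}$$ For every $r\in\mathcal U$ the functions $\tau f+\frac12\|L\cdot-r\|^2$ and $\tau g+\frac12\|K\cdot+r\|^2$ have minimizers, so both iterations can be carried out, and they are equivalent: they generate the same pairs of sequences $(x^{(i+\frac12)})_{i\in\mathbb N}$, $(y^{(i)})_{i\in\mathbb N}$. Moreover, for all sequences generated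 by either iteration (and whatever the choice of minimizers): * $(Lx^{(i+\frac12)})_{i\in\mathbb N}$ and $(-Ky^{(i)}+c)_{i\in\mathbb N}$ both converge weakly to the same element $r^\star\in\mathcal U$, which is a solution of (R); * for the ADMM, $(\tilde v^{(i+\frac12)}/\tau)_{i\in\mathbb N}$ and $(\tilde v^{(i)}/\tau)_{i\in\mathbb N}$ both converge weakly to the same element $u^\star\in\mathcal U$, which is a solution of (D); * $Lx^{(i+\frac12)}+Ky^{(i+1)}-c\to0$ strongly. Furthermore, if $\mathcal X,\mathcal Y,\mathcal U$ are finite-dimensional and, for every $r\in\mathcal U$, the minimizers of $\tau f+\frac12\|L\cdot-r\|^2$ and of $\tau g+\frac12\|K\cdot+r\|^2$ are unique, then the sequence $(x^{(i+\frac12)},y^{(i)})_{i\in\mathbb N}$ generated by either iteration converges to a solution of (P). -/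

import Mathlib

open Filter Topology
open scoped InnerProductSpace

/- Extended-real-valued functions are modelled with `EReal`; values in `ℝ ∪ {+∞}` are expressed
by the requirement `f x ≠ ⊥`. -/

/-- The class `Γ₀(H)` of convex, proper, lower semicontinuous functions from a real Hilbert
space to `ℝ ∪ {+∞}`. (In `EReal` one has `0 * ⊤ = 0`, so the convexity inequality is the usual
one also when one of the weights vanishes.) -/
structure IsGammaZero {H : Type*} [NormedAddCommGroup H] [InnerProductSpace ℝ H]
    (f : H → EReal) : Prop where
  ne_bot : ∀ x, f x ≠ ⊥
  proper : ∃ x, f x ≠ ⊤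
  convex : ∀ (x y : H) (a b : ℝ), 0 ≤ a → 0 ≤ b → a + b = 1 →
    f (a • x + b • y) ≤ (a : EReal) * f x + (b : EReal) * f y
  lsc : LowerSemicontinuous f

/-- The set of global minimizers of an extended-real-valued function. -/
def argminSet {E : Type*} (F : E → EReal) : Set E :=
  {x | ∀ x', F x ≤ F x'}

/-- The subdifferential `∂f(x) = {u : ∀ y, f x + ⟪y - x, u⟫ ≤ f y}`. -/
def subdiff {H : Type*} [NormedAddCommGroup H] [InnerProductSpace ℝ H]
    (f : H → EReal) (x : H) : Set H :=
  {u | ∀ y, f x + ((⟪y - x, u⟫_ℝ : ℝ) : EReal) ≤ f y}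

/-- The Fenchel conjugate `f*(u) = sup_x (⟪u, x⟫ - f x)`. -/
noncomputable def fenchelConj {H : Type*} [NormedAddCommGroup H] [InnerProductSpace ℝ H]
    (f : H → EReal) (u : H) : EReal :=
  ⨆ x : H, ((⟪u, x⟫_ℝ : ℝ) : EReal) - f x

/-- The infimal postcomposition `(L ▷ f)(r) = inf {f x : L x = r}`, equal to `+∞` when `r` is
not in the range of `L`. -/
noncomputable def infPostcomp {X U : Type*} (L : X → U) (f : X → EReal) (r : U) : EReal :=
  ⨅ (x : X) (_ : L x = r), f x

/-- The infimal postcomposition is exact: for every `r` in the range of `L`, the infimum over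
`L⁻¹{r}` is attained. -/
def IsExactPostcomp {X U : Type*} (L : X → U) (f : X → EReal) : Prop :=
  ∀ r ∈ Set.range L, ∃ x, L x = r ∧ ∀ x', L x' = r → f x ≤ f x'

/-- Weak convergence of a sequence: convergence in the weak topology. -/
def WeaklyTendsto {H : Type*} [NormedAddCommGroup H] [InnerProductSpace ℝ H]
    (z : ℕ → H) (a : H) : Prop :=
  Tendsto (fun n => toWeakSpace ℝ H (z n)) atTop (𝓝 (toWeakSpace ℝ H a))

section Problem

variable {X Y U : Type*}
  [NormedAddCommGroup X] [InnerProductSpace ℝ X] [CompleteSpace X]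
  [NormedAddCommGroup Y] [InnerProductSpace ℝ Y] [CompleteSpace Y]
  [NormedAddCommGroup U] [InnerProductSpace ℝ U] [CompleteSpace U]

/-- `(x, y)` solves: minimize `f x + g y` subject to `L x + K y = c`. -/
def IsPrimalSol (f : X → EReal) (g : Y → EReal) (L : X →L[ℝ] U) (K : Y →L[ℝ] U) (c : U)
    (x : X) (y : Y) : Prop :=
  L x + K y = c ∧ ∀ x' y', L x' + K y' = c → f x + g y ≤ f x' + g y'

/-- `u` solves: minimize `f*(-L* u) + g*(-K* u) + ⟪u, c⟫`. -/
def IsDualSol (f : X → EReal) (g : Y → EReal) (L : X →L[ℝ] U) (K : Y →L[ℝ] U) (c : U)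
    (u : U) : Prop :=
  u ∈ argminSet fun u : U =>
    fenchelConj f (-(L.adjoint u)) + fenchelConj g (-(K.adjoint u)) + ((⟪u, c⟫_ℝ : ℝ) : EReal)

/-- `(x, y, u)` solves the primal-dual inclusion
`0 ∈ ∂f(x) + L* u`, `0 ∈ ∂g(y) + K* u`, `0 = -L x - K y + c`. -/
def IsPrimalDualSol (f : X → EReal) (g : Y → EReal) (L : X →L[ℝ] U) (K : Y →L[ℝ] U) (c : U)
    (x : X) (y : Y) (u : U) : Prop :=
  (∃ p ∈ subdiff f x, 0 = p + L.adjoint u) ∧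
  (∃ q ∈ subdiff g y, 0 = q + K.adjoint u) ∧
  0 = -L x - K y + c

/-- `r` solves the reformulated problem: minimize `(L ▷ f)(r) + ((-K) ▷ g)(r - c)`. -/
def IsPostcompSol (f : X → EReal) (g : Y → EReal) (L : X →L[ℝ] U) (K : Y →L[ℝ] U) (c : U)
    (r : U) : Prop :=
  r ∈ argminSet fun r : U => infPostcomp L f r + infPostcomp (-K) g (r - c)

/-- The relaxed ADMM iteration; `xh i` and `vh i` stand for the iterates with index `i + 1/2`,
and `v`, `vh` are the scaled dual variables. -/
structure IsADMM (f : X → EReal) (g : Y → EReal) (L : X →L[ℝ] U) (K : Y →L[ℝ] U) (c : U)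
    (τ : ℝ) (ρ : ℕ → ℝ) (xh : ℕ → X) (y : ℕ → Y) (v vh : ℕ → U) : Prop where
  x_step : ∀ i, xh i ∈ argminSet fun x : X =>
    (τ : EReal) * f x + ((1 / 2 * ‖L x + K (y i) - c + v i‖ ^ 2 : ℝ) : EReal)
  v_half_step : ∀ i, vh i = v i + L (xh i) + K (y i) - c
  y_step : ∀ i, y (i + 1) ∈ argminSet fun y' : Y =>
    (τ : EReal) * g y' + ((1 / 2 * ‖L (xh i) + K y' - c + vh i‖ ^ 2 : ℝ) : EReal)
  v_step : ∀ i, v (i + 1) = vh i + (ρ i - 1) • (L (xh i) + K (y (i + 1)) - c)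

/-- The relaxed Douglas-Rachford iteration; `xh i` stands for the iterate with index
`i + 1/2`. The value `y 0` plays no role in it. -/
structure IsDouglasRachford (f : X → EReal) (g : Y → EReal) (L : X →L[ℝ] U) (K : Y →L[ℝ] U)
    (c : U) (τ : ℝ) (ρ : ℕ → ℝ) (xh : ℕ → X) (y : ℕ → Y) (s : ℕ → U) : Prop where
  x_step : ∀ i, xh i ∈ argminSet fun x : X =>
    (τ : EReal) * f x + ((1 / 2 * ‖L x - s i‖ ^ 2 : ℝ) : EReal)
  y_step : ∀ i, y (i + 1) ∈ argminSet fun y' : Y =>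
    (τ : EReal) * g y' + ((1 / 2 * ‖K y' - c + (2 : ℝ) • L (xh i) - s i‖ ^ 2 : ℝ) : EReal)
  s_step : ∀ i, s (i + 1) = s i - ρ i • (L (xh i) + K (y (i + 1)) - c)

end Problem

/-! Put `φ = L ▷ f` and `ψ = ((-K) ▷ g)(· - c)`. Exactness and lower semicontinuity place both in
`Γ₀(U)` (`IsGammaZero.infPostcomp`), and a minimizer `x` of `τ f + ½‖L · - s‖²` has `L x = prox_{τφ}
s`; likewise for `g`. Seen in `U`, the iteration is thus relaxed Douglas–Rachford for `φ + ψ`, with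
shadow points `p = L x` and `q = -K y + c`. ADMM is the same iteration under `s = -K y + c - v`.

`IsDRStep.exists_weaklyTendsto` carries the convergence. Firm nonexpansiveness makes `s` Fejér
monotone with respect to all `r + τ u`, `u ∈ ∂φ(r)`, `-u ∈ ∂ψ(r)`, and makes `‖p - q‖`
nonincreasing; divergence of `∑ ρ(2 - ρ)` then forces `p - q → 0`. A weak-strong closedness argument
(`mem_subdiff_of_tendsto_inner`) shows that every weak cluster point of the pair (shadow,
subgradient) is such an `(r, u)`. Opial's argument makes the limit of `s` unique, and monotonicity
of `∂φ` then makes `r` unique, so the shadow sequence converges too, although proximal maps need not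
be weakly continuous.

By Fermat's rule `r` solves the reformulated problem; lifting the subgradients through `L` and `-K`
shows that `-u` solves the dual. In finite dimension, unique minimizers depend continuously on the
data, which recovers the iterates themselves. -/

/-! ### Convexity, weak compactness and proximal points. -/

section Basics

variable {H : Type*} [NormedAddCommGroup H] [InnerProductSpace ℝ H]

theorem IsGammaZero.exists_coe_of_ne_top {φ : H → EReal} (hφ : IsGammaZero φ) {x : H}
    (hx : φ x ≠ ⊤) : ∃ a : ℝ, φ x = a :=
  ⟨(φ x).toReal, (EReal.coe_toReal hx (hφ.ne_bot x)).symm⟩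

theorem IsGammaZero.exists_coe_of_mem_subdiff {φ : H → EReal} (hφ : IsGammaZero φ) {x u : H}
    (hu : u ∈ subdiff φ x) : ∃ a : ℝ, φ x = a := by
  apply hφ.exists_coe_of_ne_top
  intro hx
  obtain ⟨z, hz⟩ := hφ.proper
  have := hu z
  rw [hx, EReal.top_add_coe, top_le_iff] at this
  exact hz this

theorem IsGammaZero.subdiff_monotone {φ : H → EReal} (hφ : IsGammaZero φ) {x y u v : H}
    (hu : u ∈ subdiff φ x) (hv : v ∈ subdiff φ y) : 0 ≤ ⟪x - y, u - v⟫_ℝ := by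
  obtain ⟨a, ha⟩ := hφ.exists_coe_of_mem_subdiff hu
  obtain ⟨b, hb⟩ := hφ.exists_coe_of_mem_subdiff hv
  have h1 := hu y
  have h2 := hv x
  rw [ha, hb] at h1 h2
  norm_cast at h1 h2
  simp only [inner_sub_left, inner_sub_right] at *
  linarith

/-- A point of the epigraph on a convex combination. -/
theorem IsGammaZero.combo_le {φ : H → EReal} (hφ : IsGammaZero φ) {x y : H} {s t a b : ℝ}
    (hx : φ x ≤ s) (hy : φ y ≤ t) (ha : 0 ≤ a) (hb : 0 ≤ b) (hab : a + b = 1) :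
    φ (a • x + b • y) ≤ ((a * s + b * t : ℝ) : EReal) := by
  refine (hφ.convex x y a b ha hb hab).trans ?_
  rw [EReal.coe_add, EReal.coe_mul, EReal.coe_mul]
  exact add_le_add (mul_le_mul_of_nonneg_left hx (by exact_mod_cast ha))
    (mul_le_mul_of_nonneg_left hy (by exact_mod_cast hb))

theorem IsGammaZero.convex_sublevel {φ : H → EReal} (hφ : IsGammaZero φ) (t : ℝ) :
    Convex ℝ {x | φ x ≤ t} := by
  intro x hx y hy a b ha hb hab
  have := hφ.combo_le hx hy ha hb hab
  rwa [← add_mul, hab, one_mul] at this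

/-- Closedness of the epigraph. -/
theorem LowerSemicontinuous.le_of_tendsto_epigraph {α ι : Type*} [TopologicalSpace α]
    {φ : α → EReal} (hφ : LowerSemicontinuous φ) {l : Filter ι} [l.NeBot] {z : ι → α} {t : ι → ℝ}
    {z₀ : α} {t₀ : ℝ} (hz : Tendsto z l (𝓝 z₀)) (ht : Tendsto t l (𝓝 t₀))
    (h : ∀ᶠ i in l, φ (z i) ≤ t i) : φ z₀ ≤ t₀ := by
  by_contra! hlt
  obtain ⟨t', h1, h2⟩ := EReal.lt_iff_exists_real_btwn.1 hlt
  have h3 : ∀ᶠ i in l, (t' : EReal) < φ (z i) := hz.eventually (hφ z₀ t' h2)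
  have h4 : ∀ᶠ i in l, t i < t' := ht.eventually (gt_mem_nhds (by exact_mod_cast h1))
  obtain ⟨i, ⟨h5, h6⟩, h7⟩ := ((h3.and h4).and h).exists
  have := h5.trans_le h7
  norm_cast at this
  exact lt_asymm this h6

/-- Weak lower semicontinuity of convex lower semicontinuous functions. -/
theorem IsGammaZero.eventually_lt_of_tendsto_inner {ι : Type*} [CompleteSpace H] {φ : H → EReal}
    (hφ : IsGammaZero φ) {l : Filter ι} {z : ι → H} {z₀ : H}
    (hz : ∀ h, Tendsto (fun i => ⟪h, z i⟫_ℝ) l (𝓝 ⟪h, z₀⟫_ℝ)) {t : ℝ} (ht : (t : EReal) < φ z₀) :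
    ∀ᶠ i in l, (t : EReal) < φ (z i) := by
  have hcl : IsClosed {x | φ x ≤ (t : EReal)} := hφ.lsc.isClosed_preimage _
  -- The sublevel set is closed and convex, so a weakly continuous functional separates it strictly
  -- from `z₀`.
  obtain ⟨F, a, h1, h2⟩ := geometric_hahn_banach_point_closed (hφ.convex_sublevel t) hcl
    (x := z₀) (not_le.2 ht)
  have hF : ∀ x, F x = ⟪(InnerProductSpace.toDual ℝ H).symm F, x⟫_ℝ := fun x => by simp
  rw [hF] at h1
  filter_upwards [(hz _).eventually (gt_mem_nhds h1)] with i hi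
  by_contra! hle
  have := h2 (z i) hle
  rw [hF] at this
  exact lt_asymm this hi

/-- Bounded sequences converge weakly along ultrafilters. -/
theorem Ultrafilter.exists_tendsto_inner {ι : Type*} [CompleteSpace H] (l : Ultrafilter ι)
    {z : ι → H} {M : ℝ} (hz : ∀ i, ‖z i‖ ≤ M) :
    ∃ z₀ : H, ∀ h, Tendsto (fun i => ⟪h, z i⟫_ℝ) l (𝓝 ⟪h, z₀⟫_ℝ) := by
  let e : ι → WeakDual ℝ H := fun i => StrongDual.toWeakDual (InnerProductSpace.toDual ℝ H (z i))
  have hc := WeakDual.isCompact_closedBall (𝕜 := ℝ) (E := H) 0 M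
  have hle : (l.map e : Filter (WeakDual ℝ H)) ≤
      𝓟 (WeakDual.toStrongDual ⁻¹' Metric.closedBall 0 M) := by
    rw [Filter.le_principal_iff]
    refine Filter.mem_map.2 (Filter.univ_mem' fun i => ?_)
    show WeakDual.toStrongDual (e i) ∈ Metric.closedBall 0 M
    rw [mem_closedBall_zero_iff]
    show ‖InnerProductSpace.toDual ℝ H (z i)‖ ≤ M
    simpa using hz i
  obtain ⟨F, -, hF⟩ := hc.ultrafilter_le_nhds _ hle
  refine ⟨(InnerProductSpace.toDual ℝ H).symm (WeakDual.toStrongDual F), fun h => ?_⟩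
  have h1 : Tendsto e l (𝓝 F) := hF
  have h2 := ((WeakDual.eval_continuous h).tendsto F).comp h1
  rw [real_inner_comm, InnerProductSpace.toDual_symm_apply]
  refine h2.congr fun i => ?_
  show ⟪z i, h⟫_ℝ = _
  exact real_inner_comm _ _

theorem weaklyTendsto_iff_inner [CompleteSpace H] {z : ℕ → H} {a : H} :
    WeaklyTendsto z a ↔ ∀ h, Tendsto (fun i => ⟪h, z i⟫_ℝ) atTop (𝓝 ⟪h, a⟫_ℝ) := by
  unfold WeaklyTendsto
  constructor
  · intro hz h
    exact ((WeakBilin.eval_continuous (topDualPairing ℝ H).flip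
      (InnerProductSpace.toDual ℝ H h)).tendsto _).comp hz
  · intro hz
    refine (WeakBilin.tendsto_iff_forall_eval_tendsto (B := (topDualPairing ℝ H).flip) ?_).2 ?_
    · intro x y hxy
      refine ext_inner_left ℝ fun h => ?_
      exact congrArg (fun F => F (InnerProductSpace.toDual ℝ H h)) hxy
    · intro F
      have := hz ((InnerProductSpace.toDual ℝ H).symm F)
      simp only [InnerProductSpace.toDual_symm_apply] at this
      exact this

/-- A function in `Γ₀` with a subgradient somewhere has proximal points. -/
theorem IsGammaZero.exists_prox [CompleteSpace H] {φ : H → EReal} (hφ : IsGammaZero φ)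
    {p₀ u₀ : H} (hu : u₀ ∈ subdiff φ p₀) {τ : ℝ} (hτ : 0 < τ) (r : H) :
    ∃ (p : H) (t : ℝ), φ p = t ∧
      ∀ (z : H) (s : ℝ), φ z ≤ s → τ * t + 1 / 2 * ‖p - r‖ ^ 2 ≤ τ * s + 1 / 2 * ‖z - r‖ ^ 2 := by
  obtain ⟨a, ha⟩ := hφ.exists_coe_of_mem_subdiff hu
  let V : H → ℝ → ℝ := fun z s => τ * s + 1 / 2 * ‖z - r‖ ^ 2
  let S : Set ℝ := {v | ∃ z s, φ z ≤ ((s : ℝ) : EReal) ∧ V z s = v}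
  have hne : S.Nonempty := ⟨V p₀ a, p₀, a, ha.le, rfl⟩
  have hbdd : BddBelow S := by
    -- The subgradient gives an affine minorant of `φ`; completing the square in `z - r` gives this
    -- bound.
    refine ⟨τ * (a + ⟪r - p₀, u₀⟫_ℝ) - 1 / 2 * ‖τ • u₀‖ ^ 2, ?_⟩
    rintro v ⟨z, s, hz, rfl⟩
    have h1 := (hu z).trans hz
    rw [ha] at h1
    norm_cast at h1
    have h2 : 0 ≤ ‖(z - r) + τ • u₀‖ ^ 2 := sq_nonneg _
    rw [norm_add_sq_real, inner_smul_right] at h2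
    have h3 : ⟪z - p₀, u₀⟫_ℝ = ⟪z - r, u₀⟫_ℝ + ⟪r - p₀, u₀⟫_ℝ := by
      rw [← inner_add_left]; congr 1; abel
    have h4 := mul_le_mul_of_nonneg_left h1 hτ.le
    simp only [V]
    rw [h3] at h4
    linarith
  set m := sInf S with hm
  have hlow : ∀ z s, φ z ≤ ((s : ℝ) : EReal) → m ≤ V z s := fun z s h =>
    csInf_le hbdd ⟨z, s, h, rfl⟩
  have hseq : ∀ n : ℕ, ∃ z s, φ z ≤ ((s : ℝ) : EReal) ∧ V z s < m + 1 / ((n : ℝ) + 1) := by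
    intro n
    obtain ⟨v, ⟨z, s, h, rfl⟩, hv⟩ := exists_lt_of_csInf_lt hne
      (show sInf S < m + 1 / ((n : ℝ) + 1) from lt_add_of_pos_right _ Nat.one_div_pos_of_nat)
    exact ⟨z, s, h, hv⟩
  choose z s hzs hV using hseq
  -- Strong convexity: the value at the midpoint is at least `m`, and the parallelogram law leaves
  -- `1/8 ‖z n - z k‖²` as the gap. Hence minimizing sequences are Cauchy.
  have hd : ∀ n k, 1 / 8 * ‖z n - z k‖ ^ 2 ≤ 1 / 2 * (1 / ((n : ℝ) + 1) + 1 / ((k : ℝ) + 1)) := by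
    intro n k
    have h1 := hlow _ _ (hφ.combo_le (hzs n) (hzs k) (a := 1 / 2) (b := 1 / 2) (by norm_num)
      (by norm_num) (by norm_num))
    have h2 := hV n
    have h3 := hV k
    have h4 := parallelogram_law_with_norm ℝ (z n - r) (z k - r)
    have h5 : ‖((1 / 2 : ℝ) • z n + (1 / 2 : ℝ) • z k) - r‖ = 1 / 2 * ‖(z n - r) + (z k - r)‖ := by
      rw [← Real.norm_of_nonneg (show (0 : ℝ) ≤ 1 / 2 by norm_num), ← norm_smul]
      congr 1
      norm_num
      module
    have h6 : (z n - r) - (z k - r) = z n - z k := by abel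
    rw [h6] at h4
    simp only [V] at h1 h2 h3
    rw [h5] at h1
    nlinarith
  have hcau : CauchySeq z := by
    refine Metric.cauchySeq_iff.2 fun ε hε => ?_
    obtain ⟨N, hN⟩ := exists_nat_one_div_lt (show (0 : ℝ) < ε ^ 2 / 8 by positivity)
    refine ⟨N, fun n hn k hk => ?_⟩
    rw [dist_eq_norm]
    have h1 := hd n k
    have h2 := Nat.one_div_le_one_div (α := ℝ) hn
    have h3 := Nat.one_div_le_one_div (α := ℝ) hk
    refine lt_of_pow_lt_pow_left₀ 2 hε.le ?_
    linarith
  obtain ⟨p, hp⟩ := cauchySeq_tendsto_of_complete hcau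
  have hVm : Tendsto (fun n => V (z n) (s n)) atTop (𝓝 m) := by
    refine tendsto_of_tendsto_of_tendsto_of_le_of_le tendsto_const_nhds
      (h := fun n : ℕ => m + 1 / ((n : ℝ) + 1)) ?_ (fun n => hlow _ _ (hzs n)) fun n => (hV n).le
    simpa using tendsto_const_nhds.add (tendsto_one_div_add_atTop_nhds_zero_nat (𝕜 := ℝ))
  -- The heights are determined by `V` and `z`, so they converge as well and the limit stays in the
  -- closed epigraph.
  have hs : Tendsto s atTop (𝓝 ((m - 1 / 2 * ‖p - r‖ ^ 2) / τ)) := by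
    have : Tendsto (fun n => (V (z n) (s n) - 1 / 2 * ‖z n - r‖ ^ 2) / τ) atTop
        (𝓝 ((m - 1 / 2 * ‖p - r‖ ^ 2) / τ)) :=
      (hVm.sub (((hp.sub_const r).norm.pow 2).const_mul _)).div_const _
    refine this.congr fun n => ?_
    simp only [V]
    field_simp
    ring
  have hle := hφ.lsc.le_of_tendsto_epigraph hp hs (.of_forall hzs)
  obtain ⟨t, ht⟩ := hφ.exists_coe_of_ne_top (ne_top_of_le_ne_top (EReal.coe_ne_top _) hle)
  refine ⟨p, t, ht, fun z' s' h' => ?_⟩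
  refine le_trans ?_ (hlow z' s' h')
  rw [ht] at hle
  norm_cast at hle
  rw [le_div_iff₀ hτ] at hle
  linarith

end Basics

/-! ### Weak convergence of Douglas–Rachford and its shadow sequence. -/

section DouglasRachford

variable {H : Type*} [NormedAddCommGroup H] [InnerProductSpace ℝ H]

/-- One evaluation of the Douglas–Rachford operator: `p = prox_{τφ} s`, `q = prox_{τψ} (2p - s)`,
in terms of subgradients. -/
structure IsDRStep (φ ψ : H → EReal) (τ : ℝ) (p q s : H) : Prop where
  left : τ⁻¹ • (s - p) ∈ subdiff φ p
  right : τ⁻¹ • ((2 : ℝ) • p - s - q) ∈ subdiff ψ q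

variable {φ ψ : H → EReal} {τ : ℝ}

/-- Firm nonexpansiveness of the Douglas–Rachford operator. -/
theorem IsDRStep.norm_sub_sq_le (hφ : IsGammaZero φ) (hψ : IsGammaZero ψ) (hτ : 0 < τ)
    {p q s p' q' s' : H} (h : IsDRStep φ ψ τ p q s) (h' : IsDRStep φ ψ τ p' q' s') :
    ‖(p - q) - (p' - q')‖ ^ 2 ≤ ⟪s - s', (p - q) - (p' - q')⟫_ℝ := by
  have h1 := hφ.subdiff_monotone h.left h'.left
  have h2 := hψ.subdiff_monotone h.right h'.right
  rw [← smul_sub, inner_smul_right] at h1 h2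
  have h3 := nonneg_of_mul_nonneg_right h1 (inv_pos.2 hτ)
  have h4 := nonneg_of_mul_nonneg_right h2 (inv_pos.2 hτ)
  have e1 : s - s' = (p - p') + ((s - p) - (s' - p')) := by abel
  have e2 : (2 : ℝ) • p - s - q - ((2 : ℝ) • p' - s' - q') =
      ((p - p') - (q - q')) - ((s - p) - (s' - p')) := by module
  have e3 : (p - q) - (p' - q') = (p - p') - (q - q') := by abel
  rw [e2] at h4
  rw [e1, e3, ← real_inner_self_eq_norm_sq]
  -- In terms of `A`, `P`, `Q` the two monotonicity inequalities add up to exactly the claim.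
  generalize (s - p) - (s' - p') = A at *
  generalize p - p' = P at *
  generalize q - q' = Q at *
  simp only [inner_sub_left, inner_sub_right, inner_add_left] at *
  have := real_inner_comm P Q
  have := real_inner_comm P A
  have := real_inner_comm Q A
  linarith

/-- The weak closedness property behind the convergence of the shadow sequence. -/
theorem add_le_add_of_tendsto_inner {ι : Type*} [CompleteSpace H] (hφ : IsGammaZero φ)
    (hψ : IsGammaZero ψ) {l : Filter ι} [l.NeBot] {p q u v : ι → H} {p₀ u₀ : H} {M : ℝ}
    (hu : ∀ i, u i ∈ subdiff φ (p i)) (hv : ∀ i, v i ∈ subdiff ψ (q i))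
    (hp : ∀ h, Tendsto (fun i => ⟪h, p i⟫_ℝ) l (𝓝 ⟪h, p₀⟫_ℝ))
    (hq : ∀ h, Tendsto (fun i => ⟪h, q i⟫_ℝ) l (𝓝 ⟪h, p₀⟫_ℝ))
    (hul : ∀ h, Tendsto (fun i => ⟪h, u i⟫_ℝ) l (𝓝 ⟪h, u₀⟫_ℝ))
    (hvl : ∀ h, Tendsto (fun i => ⟪h, v i⟫_ℝ) l (𝓝 (-⟪h, u₀⟫_ℝ)))
    (huM : ∀ i, ‖u i‖ ≤ M) (hqM : ∀ i, ‖q i‖ ≤ M)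
    (hpq : Tendsto (fun i => p i - q i) l (𝓝 0)) (huv : Tendsto (fun i => u i + v i) l (𝓝 0))
    {z w : H} {s t : ℝ} (hz : φ z = s) (hw : ψ w = t) {a b : ℝ} (ha : (a : EReal) < φ p₀)
    (hb : (b : EReal) < ψ p₀) :
    a + b + ⟪z - w, u₀⟫_ℝ ≤ s + t := by
  have h1 : Tendsto (fun i => ⟪p i - q i, u i⟫_ℝ) l (𝓝 0) := by
    refine squeeze_zero_norm (fun i => ?_) (by simpa using hpq.norm.mul_const M)
    exact (norm_inner_le_norm _ _).trans (mul_le_mul_of_nonneg_left (huM i) (norm_nonneg _))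
  have h2 : Tendsto (fun i => ⟪q i, u i + v i⟫_ℝ) l (𝓝 0) := by
    refine squeeze_zero_norm (fun i => ?_) (by simpa using huv.norm.const_mul M)
    exact (norm_inner_le_norm _ _).trans (mul_le_mul_of_nonneg_right (hqM i) (norm_nonneg _))
  -- `⟪p, u⟫ + ⟪q, v⟫` pairs weakly convergent sequences. Regrouped as `⟪p - q, u⟫ + ⟪q, u + v⟫`,
  -- each term pairs a strongly null sequence with a bounded one.
  have h3 : Tendsto (fun i => a + b + (⟪z, u i⟫_ℝ + ⟪w, v i⟫_ℝ
      - ⟪p i - q i, u i⟫_ℝ - ⟪q i, u i + v i⟫_ℝ)) l (𝓝 (a + b + ⟪z - w, u₀⟫_ℝ)) := by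
    have := (((hul z).add (hvl w)).sub h1).sub h2 |>.const_add (a + b)
    refine this.trans_eq ?_
    congr 1
    rw [inner_sub_left]
    ring
  refine le_of_tendsto h3 ?_
  filter_upwards [hφ.eventually_lt_of_tendsto_inner hp ha,
    hψ.eventually_lt_of_tendsto_inner hq hb] with i h4 h5
  obtain ⟨α, hα⟩ := hφ.exists_coe_of_mem_subdiff (hu i)
  obtain ⟨β, hβ⟩ := hψ.exists_coe_of_mem_subdiff (hv i)
  have h6 := hu i z
  have h7 := hv i w
  rw [hα] at h4 h6
  rw [hβ] at h5 h7
  rw [hz] at h6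
  rw [hw] at h7
  norm_cast at h4 h5 h6 h7
  simp only [inner_sub_left, inner_add_right] at *
  linarith

theorem mem_subdiff_of_tendsto_inner {ι : Type*} [CompleteSpace H] (hφ : IsGammaZero φ)
    (hψ : IsGammaZero ψ) {l : Filter ι} [l.NeBot] {p q u v : ι → H} {p₀ u₀ : H} {M : ℝ}
    (hu : ∀ i, u i ∈ subdiff φ (p i)) (hv : ∀ i, v i ∈ subdiff ψ (q i))
    (hp : ∀ h, Tendsto (fun i => ⟪h, p i⟫_ℝ) l (𝓝 ⟪h, p₀⟫_ℝ))
    (hq : ∀ h, Tendsto (fun i => ⟪h, q i⟫_ℝ) l (𝓝 ⟪h, p₀⟫_ℝ))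
    (hul : ∀ h, Tendsto (fun i => ⟪h, u i⟫_ℝ) l (𝓝 ⟪h, u₀⟫_ℝ))
    (hvl : ∀ h, Tendsto (fun i => ⟪h, v i⟫_ℝ) l (𝓝 (-⟪h, u₀⟫_ℝ)))
    (huM : ∀ i, ‖u i‖ ≤ M) (hqM : ∀ i, ‖q i‖ ≤ M)
    (hpq : Tendsto (fun i => p i - q i) l (𝓝 0)) (huv : Tendsto (fun i => u i + v i) l (𝓝 0)) :
    u₀ ∈ subdiff φ p₀ ∧ -u₀ ∈ subdiff ψ p₀ := by
  have key : ∀ {z w : H} {s t a b : ℝ}, φ z = s → ψ w = t → (a : EReal) < φ p₀ →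
      (b : EReal) < ψ p₀ → a + b + ⟪z - w, u₀⟫_ℝ ≤ s + t := fun hz hw ha hb =>
    add_le_add_of_tendsto_inner hφ hψ hu hv hp hq hul hvl huM hqM hpq huv hz hw ha hb
  obtain ⟨z₁, hz₁⟩ := hφ.proper
  obtain ⟨w₁, hw₁⟩ := hψ.proper
  obtain ⟨s₁, hs₁⟩ := hφ.exists_coe_of_ne_top hz₁
  obtain ⟨t₁, ht₁⟩ := hψ.exists_coe_of_ne_top hw₁
  obtain ⟨a₁, -, ha₁⟩ := EReal.lt_iff_exists_real_btwn.1 (bot_lt_iff_ne_bot.2 (hφ.ne_bot p₀))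
  obtain ⟨b₁, -, hb₁⟩ := EReal.lt_iff_exists_real_btwn.1 (bot_lt_iff_ne_bot.2 (hψ.ne_bot p₀))
  -- Otherwise `a` could be taken arbitrarily large in `key`.
  have hφtop : φ p₀ ≠ ⊤ := by
    intro htop
    have := key (a := s₁ + t₁ - b₁ - ⟪z₁ - w₁, u₀⟫_ℝ + 1) hs₁ ht₁
      (by rw [htop]; exact EReal.coe_lt_top _) hb₁
    linarith
  have hψtop : ψ p₀ ≠ ⊤ := by
    intro htop
    have := key (b := s₁ + t₁ - a₁ - ⟪z₁ - w₁, u₀⟫_ℝ + 1) hs₁ ht₁ ha₁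
      (by rw [htop]; exact EReal.coe_lt_top _)
    linarith
  obtain ⟨α, hα⟩ := hφ.exists_coe_of_ne_top hφtop
  obtain ⟨β, hβ⟩ := hψ.exists_coe_of_ne_top hψtop
  have key' : ∀ {z w : H} {s t : ℝ}, φ z = s → ψ w = t → α + β + ⟪z - w, u₀⟫_ℝ ≤ s + t := by
    intro z w s t hz hw
    refine le_of_forall_pos_le_add fun ε hε => ?_
    have := key (a := α - ε / 2) (b := β - ε / 2) hz hw
      (by rw [hα]; norm_cast; linarith) (by rw [hβ]; norm_cast; linarith)
    linarith
  -- Choosing `w = p₀`, respectively `z = p₀`, in `key'` decouples the two subgradient inequalities.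
  constructor
  · intro z
    by_cases hz : φ z = ⊤
    · rw [hz]; exact le_top
    obtain ⟨s, hs⟩ := hφ.exists_coe_of_ne_top hz
    have := key' hs hβ
    rw [hs, hα]
    norm_cast
    linarith
  · intro w
    by_cases hw : ψ w = ⊤
    · rw [hw]; exact le_top
    obtain ⟨t, ht⟩ := hψ.exists_coe_of_ne_top hw
    have := key' hα ht
    rw [ht, hβ]
    norm_cast
    rw [inner_neg_right, ← inner_neg_left, neg_sub]
    linarith

/-- A nonnegative antitone sequence whose weighted sum is bounded while the weights are not
summable tends to zero. -/
theorem tendsto_zero_of_antitone_of_sum_mul_le {d w : ℕ → ℝ} (hd : Antitone d) (hd0 : ∀ i, 0 ≤ d i)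
    (hw0 : ∀ i, 0 ≤ w i) (hw : Tendsto (fun n => ∑ i ∈ Finset.range n, w i) atTop atTop) {C : ℝ}
    (hC : ∀ n, ∑ i ∈ Finset.range n, w i * d i ≤ C) : Tendsto d atTop (𝓝 0) := by
  refine tendsto_order.2 ⟨fun a ha => .of_forall fun i => ha.trans_le (hd0 i), fun ε hε => ?_⟩
  by_contra hcon
  have hge : ∀ i, ε ≤ d i := by
    intro i
    by_contra! hlt
    exact hcon ((eventually_ge_atTop i).mono fun j hj => (hd hj).trans_lt hlt)
  obtain ⟨n, hn⟩ := (hw.eventually_gt_atTop (C / ε)).exists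
  rw [div_lt_iff₀ hε, Finset.sum_mul] at hn
  exact absurd ((Finset.sum_le_sum fun i _ =>
    mul_le_mul_of_nonneg_left (hge i) (hw0 i)).trans (hC n)) (not_le.2 hn)

/-- Identifies the fixed points `p + τ u` against which the iteration is compared. -/
theorem IsDRStep.of_mem_subdiff (hτ : 0 < τ) {p u : H} (h1 : u ∈ subdiff φ p)
    (h2 : -u ∈ subdiff ψ p) : IsDRStep φ ψ τ p p (p + τ • u) := by
  refine ⟨?_, ?_⟩
  · rwa [add_sub_cancel_left, inv_smul_smul₀ hτ.ne']
  · have : (2 : ℝ) • p - (p + τ • u) - p = τ • (-u) := by module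
    rwa [this, inv_smul_smul₀ hτ.ne']

/-- Weak convergence of the relaxed Douglas–Rachford iteration and of its shadow sequence. -/
theorem IsDRStep.exists_weaklyTendsto [CompleteSpace H] (hφ : IsGammaZero φ) (hψ : IsGammaZero ψ)
    (hτ : 0 < τ) {ρ : ℕ → ℝ} (hρ : ∀ i, ρ i ∈ Set.Icc (0 : ℝ) 2)
    (hρ_sum : Tendsto (fun n => ∑ i ∈ Finset.range n, ρ i * (2 - ρ i)) atTop atTop)
    {p₀ u₀ : H} (hp₀ : u₀ ∈ subdiff φ p₀) (hu₀ : -u₀ ∈ subdiff ψ p₀) {p q s : ℕ → H}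
    (hstep : ∀ i, IsDRStep φ ψ τ (p i) (q i) (s i))
    (hs : ∀ i, s (i + 1) = s i - ρ i • (p i - q i)) :
    ∃ r u : H, u ∈ subdiff φ r ∧ -u ∈ subdiff ψ r ∧ WeaklyTendsto p r ∧
      WeaklyTendsto s (r + τ • u) ∧ Tendsto (fun i => p i - q i) atTop (𝓝 0) := by
  set d : ℕ → H := fun i => p i - q i with hd
  have fejer : ∀ {r u : H}, u ∈ subdiff φ r → -u ∈ subdiff ψ r → ∀ i,
      ‖s (i + 1) - (r + τ • u)‖ ^ 2 + ρ i * (2 - ρ i) * ‖d i‖ ^ 2 ≤ ‖s i - (r + τ • u)‖ ^ 2 := by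
    intro r u h1 h2 i
    have h3 := (hstep i).norm_sub_sq_le hφ hψ hτ (.of_mem_subdiff hτ h1 h2)
    rw [sub_self, sub_zero] at h3
    have h4 : s (i + 1) - (r + τ • u) = (s i - (r + τ • u)) - ρ i • d i := by
      rw [hs]; abel
    rw [h4, norm_sub_sq_real, inner_smul_right, norm_smul, mul_pow, Real.norm_eq_abs, sq_abs]
    have h5 := mul_le_mul_of_nonneg_left h3 (hρ i).1
    simp only [hd]
    linarith
  have hw0 : ∀ i, 0 ≤ ρ i * (2 - ρ i) := fun i =>
    mul_nonneg (hρ i).1 (sub_nonneg.2 (hρ i).2)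
  have fejer' : ∀ {r u : H}, u ∈ subdiff φ r → -u ∈ subdiff ψ r →
      Antitone fun i => ‖s i - (r + τ • u)‖ ^ 2 := fun h1 h2 =>
    antitone_nat_of_succ_le fun i =>
      (le_add_of_nonneg_right (mul_nonneg (hw0 i) (sq_nonneg _))).trans (fejer h1 h2 i)
  have hanti : Antitone fun i => ‖d i‖ ^ 2 := by
    refine antitone_nat_of_succ_le fun i => ?_
    have h1 := (hstep i).norm_sub_sq_le hφ hψ hτ (hstep (i + 1))
    rw [hs, sub_sub_cancel, inner_smul_left] at h1
    change ‖d i - d (i + 1)‖ ^ 2 ≤ ρ i * ⟪d i, d i - d (i + 1)⟫_ℝ at h1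
    have h2 : d (i + 1) = d i - (d i - d (i + 1)) := by abel
    have h3 : ‖d (i + 1)‖ ^ 2 = ‖d i‖ ^ 2 - 2 * ⟪d i, d i - d (i + 1)⟫_ℝ
        + ‖d i - d (i + 1)‖ ^ 2 := by
      conv_lhs => rw [h2]
      exact norm_sub_sq_real _ _
    -- If `ρ i = 0`, the bound `h1` forces `d (i + 1) = d i`; if `ρ i > 0`, it makes the inner
    -- product nonnegative and `ρ i ≤ 2` suffices.
    rcases (hρ i).1.eq_or_lt with h0 | h0
    · rw [← h0, zero_mul] at h1
      have : d i - d (i + 1) = 0 := by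
        rw [← norm_eq_zero]; exact pow_eq_zero_iff two_ne_zero |>.1 (le_antisymm h1 (sq_nonneg _))
      rw [this] at h3
      simp at h3
      exact (pow_le_pow_left₀ (norm_nonneg _) (h3.le) 2)
    · have h4 : 0 ≤ ⟪d i, d i - d (i + 1)⟫_ℝ :=
        nonneg_of_mul_nonneg_right ((sq_nonneg _).trans h1) h0
      have := mul_le_mul_of_nonneg_right (hρ i).2 h4
      linarith
  have hsum : ∀ n, ∑ i ∈ Finset.range n, ρ i * (2 - ρ i) * ‖d i‖ ^ 2 ≤
      ‖s 0 - (p₀ + τ • u₀)‖ ^ 2 - ‖s n - (p₀ + τ • u₀)‖ ^ 2 := by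
    intro n
    induction n with
    | zero => simp
    | succ n ih =>
      rw [Finset.sum_range_succ]
      have := fejer hp₀ hu₀ n
      linarith
  have hd0 : Tendsto d atTop (𝓝 0) := by
    have h1 := tendsto_zero_of_antitone_of_sum_mul_le hanti (fun i => sq_nonneg _) hw0 hρ_sum
      (fun n => (hsum n).trans (sub_le_self _ (sq_nonneg _)))
    rw [tendsto_zero_iff_norm_tendsto_zero]
    have h2 := h1.sqrt
    simpa [Real.sqrt_sq (norm_nonneg _)] using h2
  -- boundedness
  obtain ⟨M, hsM, hpM, hqM, huM⟩ : ∃ M, (∀ i, ‖s i‖ ≤ M) ∧ (∀ i, ‖p i‖ ≤ M) ∧ (∀ i, ‖q i‖ ≤ M) ∧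
      ∀ i, ‖τ⁻¹ • (s i - p i)‖ ≤ M := by
    have hs1 : ∀ i, ‖s i - (p₀ + τ • u₀)‖ ≤ ‖s 0 - (p₀ + τ • u₀)‖ := fun i =>
      pow_le_pow_iff_left₀ (norm_nonneg _) (norm_nonneg _) two_ne_zero |>.1 (fejer' hp₀ hu₀ (Nat.zero_le i))
    -- Nonexpansiveness of the proximal map, from monotonicity and Cauchy–Schwarz.
    have hp1 : ∀ i, ‖p i - p₀‖ ≤ ‖s i - (p₀ + τ • u₀)‖ := by
      intro i
      have h1 := hφ.subdiff_monotone (hstep i).left hp₀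
      have h2 : τ⁻¹ • (s i - p i) - u₀ = τ⁻¹ • ((s i - (p₀ + τ • u₀)) - (p i - p₀)) := by
        rw [eq_inv_smul_iff₀ hτ.ne', smul_sub, smul_inv_smul₀ hτ.ne']; abel
      rw [h2, inner_smul_right] at h1
      have h3 := nonneg_of_mul_nonneg_right h1 (inv_pos.2 hτ)
      rw [inner_sub_right, real_inner_self_eq_norm_sq] at h3
      have h4 := real_inner_le_norm (p i - p₀) (s i - (p₀ + τ • u₀))
      rcases (norm_nonneg (p i - p₀)).eq_or_lt with h0 | h0
      · rw [← h0]; exact norm_nonneg _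
      · refine le_of_mul_le_mul_left ?_ h0
        linarith
    have hd1 : ∀ i, ‖d i‖ ≤ ‖d 0‖ := fun i => pow_le_pow_iff_left₀ (norm_nonneg _) (norm_nonneg _) two_ne_zero |>.1 (hanti (Nat.zero_le i))
    set R := ‖s 0 - (p₀ + τ • u₀)‖
    have hsb : ∀ i, ‖s i‖ ≤ R + ‖p₀ + τ • u₀‖ := fun i =>
      (norm_le_norm_sub_add _ _).trans (add_le_add_left (hs1 i) _)
    have hpb : ∀ i, ‖p i‖ ≤ R + ‖p₀‖ := fun i =>
      (norm_le_norm_sub_add _ _).trans (add_le_add_left ((hp1 i).trans (hs1 i)) _)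
    have hqb : ∀ i, ‖q i‖ ≤ R + ‖p₀‖ + ‖d 0‖ := fun i => by
      have : q i = p i - d i := by simp [hd]
      rw [this]
      exact (norm_sub_le _ _).trans (add_le_add (hpb i) (hd1 i))
    have hub : ∀ i, ‖τ⁻¹ • (s i - p i)‖ ≤ ‖τ⁻¹‖ * (R + ‖p₀ + τ • u₀‖ + (R + ‖p₀‖)) := fun i => by
      rw [norm_smul]
      exact mul_le_mul_of_nonneg_left
        ((norm_sub_le _ _).trans (add_le_add (hsb i) (hpb i))) (norm_nonneg _)
    refine ⟨max (max (R + ‖p₀ + τ • u₀‖) (R + ‖p₀‖)) (max (R + ‖p₀‖ + ‖d 0‖)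
      (‖τ⁻¹‖ * (R + ‖p₀ + τ • u₀‖ + (R + ‖p₀‖)))), fun i => ?_, fun i => ?_, fun i => ?_,
      fun i => ?_⟩
    · exact (hsb i).trans ((le_max_left _ _).trans (le_max_left _ _))
    · exact (hpb i).trans ((le_max_right _ _).trans (le_max_left _ _))
    · exact (hqb i).trans ((le_max_left _ _).trans (le_max_right _ _))
    · exact (hub i).trans ((le_max_right _ _).trans (le_max_right _ _))
  -- cluster points along ultrafilters
  have hclus : ∀ l : Ultrafilter ℕ, (l : Filter ℕ) ≤ atTop → ∃ r u : H, u ∈ subdiff φ r ∧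
      -u ∈ subdiff ψ r ∧ (∀ h, Tendsto (fun i => ⟪h, p i⟫_ℝ) l (𝓝 ⟪h, r⟫_ℝ)) ∧
      ∀ h, Tendsto (fun i => ⟪h, s i⟫_ℝ) l (𝓝 ⟪h, r + τ • u⟫_ℝ) := by
    intro l hl
    obtain ⟨r, hr⟩ := l.exists_tendsto_inner hpM
    obtain ⟨u, hu⟩ := l.exists_tendsto_inner huM
    have hdl : Tendsto d l (𝓝 0) := hd0.mono_left hl
    have hd' : ∀ h, Tendsto (fun i => ⟪h, d i⟫_ℝ) l (𝓝 0) := fun h => by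
      simpa using (tendsto_const_nhds (x := h)).inner (𝕜 := ℝ) hdl
    have hq : ∀ h, Tendsto (fun i => ⟪h, q i⟫_ℝ) l (𝓝 ⟪h, r⟫_ℝ) := fun h => by
      have := (hr h).sub (hd' h)
      rw [sub_zero] at this
      refine this.congr fun i => ?_
      rw [← inner_sub_right]; simp [hd]
    have huv : ∀ i, τ⁻¹ • (s i - p i) + τ⁻¹ • ((2 : ℝ) • p i - s i - q i) = τ⁻¹ • d i := fun i => by
      simp only [hd]; module
    obtain ⟨h1, h2⟩ := mem_subdiff_of_tendsto_inner (l := (l : Filter ℕ)) hφ hψ (u₀ := u)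
      (fun i => (hstep i).left)
      (fun i => (hstep i).right) hr hq hu (fun h => by
        have := ((hd' h).const_mul τ⁻¹).sub (hu h)
        rw [mul_zero, zero_sub] at this
        refine this.congr fun i => ?_
        rw [← inner_smul_right, ← huv, inner_add_right]
        ring) huM hqM hdl (by
        simp only [huv]
        simpa using hdl.const_smul τ⁻¹)
    refine ⟨r, u, h1, h2, hr, fun h => ?_⟩
    have := (hr h).add ((hu h).const_mul τ)
    rw [← inner_smul_right, ← inner_add_right] at this
    refine this.congr fun i => ?_
    rw [← inner_smul_right, ← inner_add_right, smul_inv_smul₀ hτ.ne', add_sub_cancel]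
  -- uniqueness of cluster points
  have hconv : ∀ {r u : H}, u ∈ subdiff φ r → -u ∈ subdiff ψ r →
      ∃ a, Tendsto (fun i => ‖s i - (r + τ • u)‖ ^ 2) atTop (𝓝 a) := fun h1 h2 =>
    ⟨_, tendsto_atTop_ciInf (fejer' h1 h2) ⟨0, by rintro _ ⟨i, rfl⟩; exact sq_nonneg _⟩⟩
  have huniq : ∀ {r u r' u' : H} (l l' : Ultrafilter ℕ), (l : Filter ℕ) ≤ atTop →
      (l' : Filter ℕ) ≤ atTop → u ∈ subdiff φ r → -u ∈ subdiff ψ r → u' ∈ subdiff φ r' →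
      -u' ∈ subdiff ψ r' → (∀ h, Tendsto (fun i => ⟪h, s i⟫_ℝ) l (𝓝 ⟪h, r + τ • u⟫_ℝ)) →
      (∀ h, Tendsto (fun i => ⟪h, s i⟫_ℝ) l' (𝓝 ⟪h, r' + τ • u'⟫_ℝ)) →
      r + τ • u = r' + τ • u' := by
    intro r u r' u' l l' hl hl' h1 h2 h3 h4 h5 h6
    obtain ⟨a, ha⟩ := hconv h1 h2
    obtain ⟨b, hb⟩ := hconv h3 h4
    have hpol := ha.sub hb
    generalize r + τ • u = σ at *
    generalize r' + τ • u' = σ' at *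
    -- Opial: the difference of squared distances converges and is affine in `s i`, so `⟪σ' - σ, s
    -- i⟫` has the same limit along both ultrafilters.
    have he : ∀ i, ‖s i - σ‖ ^ 2 - ‖s i - σ'‖ ^ 2 =
        2 * ⟪σ' - σ, s i⟫_ℝ + (‖σ‖ ^ 2 - ‖σ'‖ ^ 2) := fun i => by
      rw [norm_sub_sq_real, norm_sub_sq_real, inner_sub_left, real_inner_comm σ, real_inner_comm σ']
      ring
    simp only [he] at hpol
    have e1 := tendsto_nhds_unique (hpol.mono_left hl)
      (((h5 (σ' - σ)).const_mul 2).add_const _)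
    have e2 := tendsto_nhds_unique (hpol.mono_left hl')
      (((h6 (σ' - σ)).const_mul 2).add_const _)
    have e3 : ⟪σ' - σ, σ' - σ⟫_ℝ = 0 := by
      rw [inner_sub_right]; linarith
    exact (sub_eq_zero.1 (inner_self_eq_zero.1 e3)).symm
  obtain ⟨r, u, hr1, hr2, hr3, hr4⟩ := hclus (Ultrafilter.of atTop) (Ultrafilter.of_le _)
  have hall : ∀ l : Ultrafilter ℕ, (l : Filter ℕ) ≤ atTop →
      (∀ h, Tendsto (fun i => ⟪h, p i⟫_ℝ) l (𝓝 ⟪h, r⟫_ℝ)) ∧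
      ∀ h, Tendsto (fun i => ⟪h, s i⟫_ℝ) l (𝓝 ⟪h, r + τ • u⟫_ℝ) := by
    intro l hl
    obtain ⟨r', u', h1, h2, h3, h4⟩ := hclus l hl
    have h5 := huniq _ _ (Ultrafilter.of_le _) hl hr1 hr2 h1 h2 hr4 h4
    -- The decomposition of `r + τ u` with `u ∈ ∂φ(r)` is unique: its `r` is the proximal point.
    have h6 : r = r' := by
      have h7 := hφ.subdiff_monotone hr1 h1
      have h8 : r - r' = τ • (u' - u) := by
        rw [smul_sub, sub_eq_sub_iff_add_eq_add, h5]; abel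
      have h9 : u - u' = -(τ⁻¹ • (r - r')) := by
        rw [h8, inv_smul_smul₀ hτ.ne']; abel
      rw [h9, inner_neg_right, inner_smul_right, real_inner_self_eq_norm_sq] at h7
      have h10 : ‖r - r'‖ ^ 2 ≤ 0 := by
        by_contra! hpos
        have := mul_pos (inv_pos.2 hτ) hpos
        linarith
      exact sub_eq_zero.1 (norm_eq_zero.1 (pow_eq_zero_iff two_ne_zero |>.1
        (le_antisymm h10 (sq_nonneg _))))
    rw [h5]
    exact ⟨h6 ▸ h3, h4⟩
  refine ⟨r, u, hr1, hr2, weaklyTendsto_iff_inner.2 fun h => ?_,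
    weaklyTendsto_iff_inner.2 fun h => ?_, hd0⟩
  · exact tendsto_iff_ultrafilter _ _ _ |>.2 fun l hl => (hall l hl).1 h
  · exact tendsto_iff_ultrafilter _ _ _ |>.2 fun l hl => (hall l hl).2 h

end DouglasRachford

/-! ### Calculus of weak limits. -/

section WeakLimits

theorem WeaklyTendsto.of_succ {H : Type*} [NormedAddCommGroup H] [InnerProductSpace ℝ H]
    {z : ℕ → H} {a : H} (hz : WeaklyTendsto (fun i => z (i + 1)) a) :
    WeaklyTendsto z a :=
  (tendsto_add_atTop_iff_nat (f := fun i => toWeakSpace ℝ H (z i)) 1).1 hz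

variable {H : Type*} [NormedAddCommGroup H] [InnerProductSpace ℝ H] [CompleteSpace H]
  {z w : ℕ → H} {a b : H}

theorem WeaklyTendsto.sub (hz : WeaklyTendsto z a) (hw : WeaklyTendsto w b) :
    WeaklyTendsto (fun i => z i - w i) (a - b) := by
  rw [weaklyTendsto_iff_inner] at *
  intro h
  simp only [inner_sub_right]
  exact (hz h).sub (hw h)

theorem WeaklyTendsto.const_smul (hz : WeaklyTendsto z a) (t : ℝ) :
    WeaklyTendsto (fun i => t • z i) (t • a) := by
  rw [weaklyTendsto_iff_inner] at *
  intro h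
  simp only [inner_smul_right]
  exact (hz h).const_mul t

theorem Filter.Tendsto.weaklyTendsto (hz : Tendsto z atTop (𝓝 a)) : WeaklyTendsto z a :=
  weaklyTendsto_iff_inner.2 fun _ => tendsto_const_nhds.inner hz

theorem WeaklyTendsto.tendsto [FiniteDimensional ℝ H] (hz : WeaklyTendsto z a) :
    Tendsto z atTop (𝓝 a) := by
  rw [weaklyTendsto_iff_inner] at hz
  have h : Tendsto (fun i => ∑ j, ⟪stdOrthonormalBasis ℝ H j, z i⟫_ℝ • stdOrthonormalBasis ℝ H j)
      atTop (𝓝 (∑ j, ⟪stdOrthonormalBasis ℝ H j, a⟫_ℝ • stdOrthonormalBasis ℝ H j)) :=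
    tendsto_finsetSum _ fun j _ => (hz _).smul_const _
  simpa only [OrthonormalBasis.sum_repr'] using h

end WeakLimits

/-! ### Minimizers of regularized objectives and their stability. -/

section Minimizers

variable {X : Type*} [NormedAddCommGroup X] [InnerProductSpace ℝ X] {f : X → EReal} {τ : ℝ}

/-- Passing to real epigraph heights keeps later arguments out of `EReal` arithmetic. -/
theorem IsGammaZero.mem_argminSet_iff (hf : IsGammaZero f) (hτ : 0 < τ) {N : X → ℝ} {x : X} :
    x ∈ argminSet (fun x => (τ : EReal) * f x + (N x : EReal)) ↔
      ∃ a : ℝ, f x = a ∧ ∀ (x' : X) (b : ℝ), f x' ≤ b → τ * a + N x ≤ τ * b + N x' := by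
  constructor
  · intro hx
    have hne : f x ≠ ⊤ := by
      intro htop
      obtain ⟨z, hz⟩ := hf.proper
      obtain ⟨b, hb⟩ := hf.exists_coe_of_ne_top hz
      have := hx z
      simp only [htop, hb, EReal.coe_mul_top_of_pos hτ, EReal.top_add_coe, top_le_iff] at this
      rw [← EReal.coe_mul, ← EReal.coe_add] at this
      exact EReal.coe_ne_top _ this
    obtain ⟨a, ha⟩ := hf.exists_coe_of_ne_top hne
    refine ⟨a, ha, fun x' b hb => ?_⟩
    obtain ⟨b', hb'⟩ := hf.exists_coe_of_ne_top (ne_top_of_le_ne_top (EReal.coe_ne_top _) hb)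
    have := hx x'
    simp only [ha, hb'] at this
    rw [hb'] at hb
    norm_cast at this hb
    linarith [mul_le_mul_of_nonneg_left hb hτ.le]
  · rintro ⟨a, ha, h⟩ x'
    by_cases hx' : f x' = ⊤
    · simp only [hx', EReal.coe_mul_top_of_pos hτ, EReal.top_add_coe, le_top]
    obtain ⟨b, hb⟩ := hf.exists_coe_of_ne_top hx'
    simp only [ha, hb]
    exact_mod_cast h x' b hb.le

/-- In finite dimension, minimizing sequences of a convex lower semicontinuous function with a
unique minimizer converge. -/
theorem IsGammaZero.tendsto_of_subsingleton_argminSet [FiniteDimensional ℝ X] (hf : IsGammaZero f)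
    (hτ : 0 < τ) {N : X → ℝ} (hN : ConvexOn ℝ Set.univ N) (hNc : Continuous N) {x₀ : X} {a₀ : ℝ}
    (hx₀ : f x₀ = a₀)
    (hmin : x₀ ∈ argminSet fun x => (τ : EReal) * f x + (N x : EReal))
    (huniq : (argminSet fun x => (τ : EReal) * f x + (N x : EReal)).Subsingleton)
    {x : ℕ → X} {a ε : ℕ → ℝ} (hx : ∀ n, f (x n) = a n) (hε : Tendsto ε atTop (𝓝 0))
    (hle : ∀ n, τ * a n + N (x n) ≤ τ * a₀ + N x₀ + ε n) : Tendsto x atTop (𝓝 x₀) := by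
  obtain ⟨a₀', ha₀', hmin'⟩ := (hf.mem_argminSet_iff hτ).1 hmin
  obtain rfl : a₀ = a₀' := by rw [hx₀] at ha₀'; exact_mod_cast ha₀'
  by_contra hcon
  rw [Metric.tendsto_nhds] at hcon
  push Not at hcon
  obtain ⟨δ, hδ, hfreq⟩ := hcon
  let l₀ : Filter ℕ := atTop ⊓ 𝓟 {n | δ ≤ dist (x n) x₀}
  have : l₀.NeBot := by
    refine frequently_mem_iff_neBot.1 (hfreq.mono fun n hn => ?_)
    simpa using hn
  let l := Ultrafilter.of l₀
  have hl : (l : Filter ℕ) ≤ atTop := (Ultrafilter.of_le l₀).trans inf_le_left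
  have hl' : ∀ᶠ n in (l : Filter ℕ), δ ≤ ‖x n - x₀‖ := by
    have : {n | δ ≤ dist (x n) x₀} ∈ l₀ := mem_inf_of_right (mem_principal_self _)
    filter_upwards [Ultrafilter.of_le l₀ this] with n hn
    rwa [← dist_eq_norm]
  let t : ℕ → ℝ := fun n => δ / ‖x n - x₀‖
  -- Points `x n` staying away from `x₀` are pulled back along the segment to the compact sphere of
  -- radius `δ`. By convexity the pulled-back points still minimize asymptotically, so a cluster
  -- point is a second minimizer.
  let z : ℕ → X := fun n => (1 - t n) • x₀ + t n • x n
  have hz : ∀ n, z n - x₀ = t n • (x n - x₀) := fun n => by simp only [z]; module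
  have hsph : ∀ᶠ n in (l : Filter ℕ), z n ∈ Metric.sphere x₀ δ := by
    filter_upwards [hl'] with n hn
    have hpos := hδ.trans_le hn
    rw [mem_sphere_iff_norm, hz, norm_smul, Real.norm_of_nonneg (by positivity)]
    exact div_mul_cancel₀ _ hpos.ne'
  obtain ⟨z₀, hz₀, hlim⟩ := (isCompact_sphere x₀ δ).ultrafilter_le_nhds (l.map z)
    (le_principal_iff.2 hsph)
  have hlim' : Tendsto z l (𝓝 z₀) := hlim
  have hepi : f z₀ ≤ (((τ * a₀ + N x₀ + 0 - N z₀) / τ : ℝ) : EReal) := by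
    refine hf.lsc.le_of_tendsto_epigraph (t := fun n => (τ * a₀ + N x₀ + ε n - N (z n)) / τ)
      hlim' ((((hε.mono_left hl).const_add _).sub ((hNc.tendsto _).comp hlim')).div_const _) ?_
    filter_upwards [hl'] with n hn
    have hpos := hδ.trans_le hn
    have ht0 : 0 ≤ t n := by positivity
    have ht1 : t n ≤ 1 := (div_le_one hpos).2 hn
    refine (hf.combo_le hx₀.le (hx n).le (sub_nonneg.2 ht1) ht0 (by ring)).trans ?_
    rw [EReal.coe_le_coe_iff, le_div_iff₀ hτ]
    have h1 := hN.2 (Set.mem_univ x₀) (Set.mem_univ (x n)) (sub_nonneg.2 ht1) ht0 (by ring)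
    simp only [smul_eq_mul] at h1
    have h2 := mul_le_mul_of_nonneg_left (hle n) ht0
    -- Minimality of `x₀` makes the error nonnegative, so `t n * ε n ≤ ε n`.
    have hε0 : 0 ≤ ε n := by linarith [hmin' (x n) (a n) (hx n).le, hle n]
    have h3 := mul_le_mul_of_nonneg_right ht1 hε0
    simp only [z]
    linarith
  obtain ⟨b, hb⟩ := hf.exists_coe_of_ne_top (ne_top_of_le_ne_top (EReal.coe_ne_top _) hepi)
  have hzmin : z₀ ∈ argminSet fun x => (τ : EReal) * f x + (N x : EReal) := by
    refine (hf.mem_argminSet_iff hτ).2 ⟨b, hb, fun x' b' hb' => ?_⟩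
    refine le_trans ?_ (hmin' x' b' hb')
    rw [hb, EReal.coe_le_coe_iff, le_div_iff₀ hτ] at hepi
    linarith
  rw [huniq hzmin hmin, mem_sphere_iff_norm, sub_self, norm_zero] at hz₀
  exact hδ.ne hz₀

end Minimizers

/-! ### Infimal postcompositions: regularity, subproblems, subgradients. -/

section Postcomposition

variable {X U : Type*} [NormedAddCommGroup X] [InnerProductSpace ℝ X]
  [NormedAddCommGroup U] [InnerProductSpace ℝ U] {f : X → EReal} {τ : ℝ}

theorem infPostcomp_apply_le {X U : Type*} (L : X → U) (f : X → EReal) (x : X) :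
    infPostcomp L f (L x) ≤ f x :=
  iInf₂_le (f := fun x' (_ : L x' = L x) => f x') x rfl

theorem IsExactPostcomp.exists_eq {X U : Type*} {L : X → U} {f : X → EReal}
    (h : IsExactPostcomp L f) {r : U} (hr : infPostcomp L f r ≠ ⊤) :
    ∃ x, L x = r ∧ infPostcomp L f r = f x := by
  have hmem : r ∈ Set.range L := by
    by_contra hr'
    refine hr ?_
    simp only [infPostcomp, iInf_eq_top]
    exact fun x hx => absurd ⟨x, hx⟩ hr'
  obtain ⟨x, hx, hmin⟩ := h r hmem
  exact ⟨x, hx, le_antisymm (hx ▸ infPostcomp_apply_le L f x) (le_iInf₂ hmin)⟩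

/-- Exactness turns each finite infimum into a value of `f`, which excludes `⊥` and lets the
convexity inequality of `f` be applied to the minimizers. -/
theorem IsGammaZero.infPostcomp (hf : IsGammaZero f) {L : X →L[ℝ] U} (hL : IsExactPostcomp L f)
    (hlsc : LowerSemicontinuous (infPostcomp L f)) : IsGammaZero (infPostcomp L f) := by
  have hbot : ∀ r, _root_.infPostcomp L f r ≠ ⊥ := by
    intro r hr
    obtain ⟨x, -, hx⟩ := hL.exists_eq (hr.trans_ne bot_ne_top)
    exact hf.ne_bot x (hx.symm.trans hr)
  refine ⟨hbot, ?_, ?_, hlsc⟩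
  · obtain ⟨x, hx⟩ := hf.proper
    exact ⟨L x, ne_top_of_le_ne_top hx (infPostcomp_apply_le L f x)⟩
  · intro r r' a b ha hb hab
    rcases ha.eq_or_lt with rfl | ha'
    · obtain rfl : b = 1 := by linarith
      simp
    rcases hb.eq_or_lt with rfl | hb'
    · obtain rfl : a = 1 := by linarith
      simp
    have hmulbot : ∀ {t : ℝ} (r : U), 0 < t → (t : EReal) * _root_.infPostcomp L f r ≠ ⊥ := by
      intro t r ht h
      by_cases hr : _root_.infPostcomp L f r = ⊤
      · rw [hr, EReal.coe_mul_top_of_pos ht] at h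
        exact bot_ne_top h.symm
      · rw [← EReal.coe_toReal hr (hbot r), ← EReal.coe_mul] at h
        exact EReal.coe_ne_bot _ h
    by_cases hr : _root_.infPostcomp L f r = ⊤
    · rw [hr, EReal.coe_mul_top_of_pos ha', EReal.top_add_of_ne_bot (hmulbot r' hb')]
      exact le_top
    by_cases hr' : _root_.infPostcomp L f r' = ⊤
    · rw [hr', EReal.coe_mul_top_of_pos hb', EReal.add_top_of_ne_bot (hmulbot r ha')]
      exact le_top
    obtain ⟨x, rfl, hx⟩ := hL.exists_eq hr
    obtain ⟨x', rfl, hx'⟩ := hL.exists_eq hr'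
    rw [hx, hx', ← map_smul, ← map_smul, ← map_add]
    exact (infPostcomp_apply_le L f _).trans (hf.convex x x' a b ha hb hab)

theorem IsGammaZero.comp_sub_const {φ : U → EReal} (hφ : IsGammaZero φ) (c : U) :
    IsGammaZero fun r => φ (r - c) := by
  refine ⟨fun r => hφ.ne_bot _, ?_, fun r r' a b ha hb hab => ?_, ?_⟩
  · obtain ⟨r, hr⟩ := hφ.proper
    exact ⟨r + c, by simpa using hr⟩
  · have : a • r + b • r' - c = a • (r - c) + b • (r' - c) := by
      rw [smul_sub, smul_sub, sub_add_sub_comm, ← add_smul, hab, one_smul]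
    rw [this]
    exact hφ.convex _ _ a b ha hb hab
  · exact hφ.lsc.comp (continuous_id.sub continuous_const)

theorem mem_subdiff_comp_sub_const {φ : U → EReal} {c r w : U} :
    w ∈ subdiff (fun r => φ (r - c)) r ↔ w ∈ subdiff φ (r - c) := by
  constructor
  · intro h z
    have := h (z + c)
    simp only [add_sub_cancel_right] at this
    rwa [show z + c - r = z - (r - c) by abel] at this
  · intro h z
    have := h (z - c)
    rwa [sub_sub_sub_cancel_right] at this

/-- The regularized subproblems are solvable when the infimal postcomposition is exact, lower
semicontinuous, and has a subgradient. -/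
theorem IsGammaZero.exists_mem_argminSet [CompleteSpace U] (hf : IsGammaZero f) {L : X →L[ℝ] U}
    (hL : IsExactPostcomp L f) (hlsc : LowerSemicontinuous (_root_.infPostcomp L f)) (hτ : 0 < τ)
    {p₀ u₀ : U} (hu : u₀ ∈ subdiff (_root_.infPostcomp L f) p₀) (s : U) :
    (argminSet fun x : X =>
      (τ : EReal) * f x + ((1 / 2 * ‖L x - s‖ ^ 2 : ℝ) : EReal)).Nonempty := by
  obtain ⟨p, t, hp, hmin⟩ := (hf.infPostcomp hL hlsc).exists_prox hu hτ s
  obtain ⟨x, rfl, hx⟩ := hL.exists_eq (hp.trans_ne (EReal.coe_ne_top t))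
  exact ⟨x, (hf.mem_argminSet_iff hτ).2 ⟨t, hx.symm.trans hp, fun x' b hb =>
    hmin (L x') b ((infPostcomp_apply_le L f x').trans hb)⟩⟩

/-- The `x n` form a minimizing sequence for the limit problem: replacing `s n` by `s₀` costs an
error that vanishes because `L (x n)` and `s n` converge. -/
theorem IsGammaZero.tendsto_of_mem_argminSet [FiniteDimensional ℝ X] (hf : IsGammaZero f)
    (hτ : 0 < τ) {L : X →L[ℝ] U} {s : ℕ → U} {s₀ r : U} {x : ℕ → X} {x₀ : X}
    (hx : ∀ n, x n ∈ argminSet fun x : X =>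
      (τ : EReal) * f x + ((1 / 2 * ‖L x - s n‖ ^ 2 : ℝ) : EReal))
    (hx₀ : x₀ ∈ argminSet fun x : X =>
      (τ : EReal) * f x + ((1 / 2 * ‖L x - s₀‖ ^ 2 : ℝ) : EReal))
    (huniq : (argminSet fun x : X =>
      (τ : EReal) * f x + ((1 / 2 * ‖L x - s₀‖ ^ 2 : ℝ) : EReal)).Subsingleton)
    (hs : Tendsto s atTop (𝓝 s₀)) (hLx : Tendsto (fun n => L (x n)) atTop (𝓝 r)) :
    Tendsto x atTop (𝓝 x₀) := by
  choose a ha hmin using fun n => (hf.mem_argminSet_iff hτ).1 (hx n)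
  obtain ⟨a₀, ha₀, -⟩ := (hf.mem_argminSet_iff hτ).1 hx₀
  have hconv : ConvexOn ℝ Set.univ fun x : X => 1 / 2 * ‖L x - s₀‖ ^ 2 := by
    refine ⟨convex_univ, fun x _ y _ α β hα hβ hαβ => ?_⟩
    have h1 := (convexOn_univ_norm (E := U)).pow (fun _ _ => norm_nonneg _) 2 |>.2
      (Set.mem_univ (L x - s₀)) (Set.mem_univ (L y - s₀)) hα hβ hαβ
    have h2 : L (α • x + β • y) - s₀ = α • (L x - s₀) + β • (L y - s₀) := by
      rw [map_add, map_smul, map_smul, smul_sub, smul_sub, sub_add_sub_comm, ← add_smul, hαβ,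
        one_smul]
    simp only [Pi.pow_apply, smul_eq_mul] at h1 ⊢
    rw [h2]
    linarith
  refine hf.tendsto_of_subsingleton_argminSet hτ hconv (by fun_prop) ha₀ hx₀ huniq ha
    (ε := fun n => (1 / 2 * ‖L (x n) - s₀‖ ^ 2 - 1 / 2 * ‖L (x n) - s n‖ ^ 2) +
      (1 / 2 * ‖L x₀ - s n‖ ^ 2 - 1 / 2 * ‖L x₀ - s₀‖ ^ 2)) ?_ fun n => ?_
  · have h1 := ((hLx.sub_const s₀).norm.pow 2).const_mul (1 / 2)
    have h2 := ((hLx.sub hs).norm.pow 2).const_mul (1 / 2)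
    have h3 := ((hs.const_sub (L x₀)).norm.pow 2).const_mul (1 / 2)
    have := (h1.sub h2).add (h3.sub_const (1 / 2 * ‖L x₀ - s₀‖ ^ 2))
    simpa using this
  · have := hmin n x₀ a₀ ha₀.le
    linarith

variable [CompleteSpace X] [CompleteSpace U]

theorem mem_subdiff_adjoint_iff {L : X →L[ℝ] U} {x : X} {w : U} :
    L.adjoint w ∈ subdiff f x ↔ ∀ x', f x + ((⟪L x' - L x, w⟫_ℝ : ℝ) : EReal) ≤ f x' := by
  refine forall_congr' fun x' => ?_
  rw [ContinuousLinearMap.adjoint_inner_right, map_sub]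

/-- Optimality condition for the regularized subproblems. -/
theorem IsGammaZero.adjoint_mem_subdiff (hf : IsGammaZero f) (hτ : 0 < τ) {L : X →L[ℝ] U}
    {x : X} {s : U}
    (hx : x ∈ argminSet fun x : X =>
      (τ : EReal) * f x + ((1 / 2 * ‖L x - s‖ ^ 2 : ℝ) : EReal)) :
    L.adjoint (τ⁻¹ • (s - L x)) ∈ subdiff f x := by
  rw [mem_subdiff_adjoint_iff]
  intro x'
  obtain ⟨a, ha, hmin⟩ := (hf.mem_argminSet_iff hτ).1 hx
  by_cases hx' : f x' = ⊤
  · rw [hx']; exact le_top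
  obtain ⟨b, hb⟩ := hf.exists_coe_of_ne_top hx'
  -- Compare `x` with `(1 - t) x + t x'` and divide by `t`; the first-order term must be
  -- nonnegative.
  have hineq : ∀ t : ℝ, 0 < t → t ≤ 1 →
      0 ≤ (τ * (b - a) - ⟪L x' - L x, s - L x⟫_ℝ) + t * (1 / 2 * ‖L x' - L x‖ ^ 2) := by
    intro t ht0 ht1
    have h1 := hmin _ _ (hf.combo_le ha.le hb.le (sub_nonneg.2 ht1) ht0.le (by ring))
    have h2 : L ((1 - t) • x + t • x') - s = t • (L x' - L x) - (s - L x) := by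
      rw [map_add, map_smul, map_smul]; module
    rw [h2, norm_sub_rev (L x) s, norm_sub_sq_real (t • _), inner_smul_left, norm_smul, mul_pow,
      Real.norm_eq_abs, sq_abs] at h1
    simp only [conj_trivial] at h1
    refine nonneg_of_mul_nonneg_right ?_ ht0
    nlinarith
  have hmain : 0 ≤ τ * (b - a) - ⟪L x' - L x, s - L x⟫_ℝ := by
    by_contra! hneg
    generalize τ * (b - a) - ⟪L x' - L x, s - L x⟫_ℝ = A at *
    have hC : 0 ≤ 1 / 2 * ‖L x' - L x‖ ^ 2 := by positivity
    generalize 1 / 2 * ‖L x' - L x‖ ^ 2 = C at *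
    have hpos : 0 < C - A := by linarith
    -- This `t` lies in `(0, 1]` and makes `A + t C = -A² / (C - A) < 0`.
    have h1 := hineq (-A / (C - A)) (div_pos (by linarith) hpos)
      ((div_le_one hpos).2 (by linarith))
    have h2 : A + -A / (C - A) * C = -A ^ 2 / (C - A) := by field_simp; ring
    rw [h2] at h1
    have := div_neg_of_neg_of_pos (show -A ^ 2 < 0 by nlinarith) hpos
    linarith
  rw [ha, hb, inner_smul_right]
  norm_cast
  rw [← le_sub_iff_add_le', inv_mul_le_iff₀ hτ]
  linarith

theorem mem_subdiff_infPostcomp {L : X →L[ℝ] U} {x : X} {w : U}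
    (h : L.adjoint w ∈ subdiff f x) : w ∈ subdiff (infPostcomp L f) (L x) := by
  rw [mem_subdiff_adjoint_iff] at h
  intro r
  refine le_iInf₂ fun x' hx' => ?_
  rw [← hx']
  exact (add_le_add_left (infPostcomp_apply_le L f x) _).trans (h x')

/-- Converse of `mem_subdiff_infPostcomp`; exactness supplies the point of the fibre at which `w`
lifts. -/
theorem IsGammaZero.exists_adjoint_mem_subdiff {L : X →L[ℝ] U}
    (hφ : IsGammaZero (_root_.infPostcomp L f)) (hL : IsExactPostcomp L f) {r w : U}
    (h : w ∈ subdiff (_root_.infPostcomp L f) r) : ∃ x, L x = r ∧ L.adjoint w ∈ subdiff f x := by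
  obtain ⟨a, ha⟩ := hφ.exists_coe_of_mem_subdiff h
  obtain ⟨x, rfl, hx⟩ := hL.exists_eq (ha.trans_ne (EReal.coe_ne_top a))
  refine ⟨x, rfl, mem_subdiff_adjoint_iff.2 fun x' => ?_⟩
  rw [← hx]
  exact (h (L x')).trans (infPostcomp_apply_le L f x')

end Postcomposition

/-! ### Equivalence of the two iterations, optimality, and convergence. -/

section ADMM

variable {X Y U : Type*}
  [NormedAddCommGroup X] [InnerProductSpace ℝ X]
  [NormedAddCommGroup Y] [InnerProductSpace ℝ Y]
  [NormedAddCommGroup U] [InnerProductSpace ℝ U]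
  {f : X → EReal} {g : Y → EReal} {L : X →L[ℝ] U} {K : Y →L[ℝ] U} {c : U}
  {τ : ℝ} {ρ : ℕ → ℝ} {xh : ℕ → X} {y : ℕ → Y}

theorem IsADMM.isDouglasRachford {v vh : ℕ → U} (h : IsADMM f g L K c τ ρ xh y v vh) :
    IsDouglasRachford f g L K c τ ρ xh y fun i => -K (y i) + c - v i := by
  refine ⟨fun i => ?_, fun i => ?_, fun i => ?_⟩
  · have := h.x_step i
    simp only [show ∀ x, L x + K (y i) - c + v i = L x - (-K (y i) + c - v i) from
      fun x => by abel] at this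
    exact this
  · have := h.y_step i
    simp only [h.v_half_step] at this
    simp only [show ∀ y', L (xh i) + K y' - c + (v i + L (xh i) + K (y i) - c) =
      K y' - c + (2 : ℝ) • L (xh i) - (-K (y i) + c - v i) from fun y' => by module] at this
    exact this
  · simp only [h.v_step, h.v_half_step]
    module

theorem IsDouglasRachford.isADMM {s : ℕ → U} (h : IsDouglasRachford f g L K c τ ρ xh y s) :
    IsADMM f g L K c τ ρ xh y (fun i => -K (y i) + c - s i) (fun i => L (xh i) - s i) := by
  refine ⟨fun i => ?_, fun i => ?_, fun i => ?_, fun i => ?_⟩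
  · simp only [show ∀ x, L x + K (y i) - c + (-K (y i) + c - s i) = L x - s i from
      fun x => by abel]
    exact h.x_step i
  · abel
  · simp only [show ∀ y', L (xh i) + K y' - c + (L (xh i) - s i) =
      K y' - c + (2 : ℝ) • L (xh i) - s i from fun y' => by module]
    exact h.y_step i
  · simp only [h.s_step]
    module

/-- Puts the `g`-subproblem in the form of the `f`-subproblem, with `-K` as operator. -/
theorem argminSet_norm_add_eq (s : U) :
    (argminSet fun y : Y => (τ : EReal) * g y + ((1 / 2 * ‖K y + s‖ ^ 2 : ℝ) : EReal)) =
      argminSet fun y : Y => (τ : EReal) * g y + ((1 / 2 * ‖(-K) y - s‖ ^ 2 : ℝ) : EReal) := by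
  simp only [neg_apply, ← neg_add', norm_neg]

theorem IsDouglasRachford.mem_argminSet {s : ℕ → U}
    (h : IsDouglasRachford f g L K c τ ρ xh y s) (i : ℕ) :
    y (i + 1) ∈ argminSet fun y' : Y => (τ : EReal) * g y' +
      ((1 / 2 * ‖(-K) y' - ((2 : ℝ) • L (xh i) - s i - c)‖ ^ 2 : ℝ) : EReal) := by
  rw [← argminSet_norm_add_eq]
  have := h.y_step i
  simp only [show ∀ y', K y' - c + (2 : ℝ) • L (xh i) - s i =
    K y' + ((2 : ℝ) • L (xh i) - s i - c) from fun y' => by abel] at this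
  exact this

/-- Fermat's rule: the linear terms of the opposite subgradients `w` and `-w` cancel in the sum. -/
theorem isPostcompSol_of_mem_subdiff (hφ : IsGammaZero (infPostcomp L f))
    (hψ : IsGammaZero (infPostcomp (-K) g)) {r w : U} (h1 : w ∈ subdiff (infPostcomp L f) r)
    (h2 : -w ∈ subdiff (infPostcomp (-K) g) (r - c)) : IsPostcompSol f g L K c r := by
  obtain ⟨a, ha⟩ := hφ.exists_coe_of_mem_subdiff h1
  obtain ⟨b, hb⟩ := hψ.exists_coe_of_mem_subdiff h2
  intro z
  have := add_le_add (h1 z) (h2 (z - c))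
  refine le_trans (le_of_eq ?_) this
  simp only [ha, hb, sub_sub_sub_cancel_right, inner_neg_right]
  norm_cast
  ring

theorem le_fenchelConj {H : Type*} [NormedAddCommGroup H] [InnerProductSpace ℝ H] {f : H → EReal}
    {x : H} {a : ℝ} (hx : f x = a) (v : H) : ((⟪v, x⟫_ℝ - a : ℝ) : EReal) ≤ fenchelConj f v := by
  have := le_iSup (fun x : H => ((⟪v, x⟫_ℝ : ℝ) : EReal) - f x) x
  rwa [hx, ← EReal.coe_sub] at this

theorem fenchelConj_le_of_mem_subdiff {H : Type*} [NormedAddCommGroup H] [InnerProductSpace ℝ H]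
    {f : H → EReal} (hf : IsGammaZero f) {x v : H} {a : ℝ} (hx : f x = a) (h : v ∈ subdiff f x) :
    fenchelConj f v ≤ ((⟪v, x⟫_ℝ - a : ℝ) : EReal) := by
  refine iSup_le fun z => ?_
  by_cases hz : f z = ⊤
  · rw [hz, sub_eq_add_neg, EReal.neg_top, EReal.add_bot]
    exact bot_le
  obtain ⟨b, hb⟩ := hf.exists_coe_of_ne_top hz
  have := h z
  rw [hx, hb] at this
  rw [hb]
  norm_cast at this ⊢
  rw [inner_sub_left, real_inner_comm, real_inner_comm v x] at this
  linarith

variable [CompleteSpace X] [CompleteSpace Y] [CompleteSpace U]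

/-- A solution of the primal-dual inclusion solves the corresponding inclusion for the infimal
postcompositions. -/
theorem IsPrimalDualSol.exists_mem_subdiff {x : X} {y : Y} {u : U}
    (h : IsPrimalDualSol f g L K c x y u) :
    -u ∈ subdiff (infPostcomp L f) (L x) ∧ u ∈ subdiff (infPostcomp (-K) g) (L x - c) := by
  obtain ⟨⟨a, ha, ha'⟩, ⟨b, hb, hb'⟩, hc⟩ := h
  constructor
  · apply mem_subdiff_infPostcomp
    rwa [map_neg, ← eq_neg_of_add_eq_zero_left ha'.symm]
  · have : L x - c = (-K) y := by
      rw [neg_apply, ← sub_eq_zero]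
      have := neg_eq_zero.2 hc.symm
      rw [← this]; abel
    rw [this]
    apply mem_subdiff_infPostcomp
    rwa [map_neg, neg_apply, ← eq_neg_of_add_eq_zero_left hb'.symm]

/-- Convergence of the Douglas–Rachford iteration in terms of the infimal postcompositions. -/
theorem IsDouglasRachford.exists_weaklyTendsto (hf : IsGammaZero f) (hg : IsGammaZero g)
    (hφ : IsGammaZero (infPostcomp L f)) (hψ : IsGammaZero (infPostcomp (-K) g))
    (hsol : ∃ (x : X) (y : Y) (u : U), IsPrimalDualSol f g L K c x y u)
    (hτ : 0 < τ) (hρ : ∀ i, ρ i ∈ Set.Icc (0 : ℝ) 2)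
    (hρ_sum : Tendsto (fun n => ∑ i ∈ Finset.range n, ρ i * (2 - ρ i)) atTop atTop) {s : ℕ → U}
    (h : IsDouglasRachford f g L K c τ ρ xh y s) :
    ∃ r w : U, w ∈ subdiff (infPostcomp L f) r ∧ -w ∈ subdiff (infPostcomp (-K) g) (r - c) ∧
      WeaklyTendsto (fun i => L (xh i)) r ∧ WeaklyTendsto (fun i => -K (y i) + c) r ∧
      WeaklyTendsto s (r + τ • w) ∧
      Tendsto (fun i => L (xh i) + K (y (i + 1)) - c) atTop (𝓝 0) := by
  obtain ⟨x₀, y₀, u₀, hsol⟩ := hsol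
  have h0 := hsol.exists_mem_subdiff
  have hd : ∀ i, L (xh i) - (-K (y (i + 1)) + c) = L (xh i) + K (y (i + 1)) - c :=
    fun i => by abel
  obtain ⟨r, w, h1, h2, h3, h4, h5⟩ := IsDRStep.exists_weaklyTendsto hφ (hψ.comp_sub_const c) hτ
    hρ hρ_sum h0.1 (by rw [mem_subdiff_comp_sub_const, neg_neg]; exact h0.2)
    (p := fun i => L (xh i)) (q := fun i => -K (y (i + 1)) + c) (s := s)
    (fun i => ⟨mem_subdiff_infPostcomp (hf.adjoint_mem_subdiff hτ (h.x_step i)), by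
      rw [mem_subdiff_comp_sub_const, add_sub_cancel_right]
      have := mem_subdiff_infPostcomp (hg.adjoint_mem_subdiff hτ (h.mem_argminSet i))
      have hK : (-K) (y (i + 1)) = -K (y (i + 1)) := rfl
      rw [sub_right_comm _ c, sub_sub _ _ c, hK] at this
      exact this⟩)
    (fun i => by rw [h.s_step, hd])
  rw [mem_subdiff_comp_sub_const] at h2
  simp only [hd] at h5
  -- The Douglas–Rachford step controls `y (i + 1)` only; the value `y 0` does not affect the limit.
  refine ⟨r, w, h1, h2, h3, WeaklyTendsto.of_succ ?_, h4, h5⟩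
  have := h3.sub h5.weaklyTendsto
  rw [sub_zero] at this
  convert this using 2
  abel

/-- Lift `w` to `x`, `y` with `L x + K y = c`. Fenchel–Young at these points bounds the dual
objective below by `-(f x + g y)` for every `u`, with equality at `-w`. -/
theorem isDualSol_of_mem_subdiff (hf : IsGammaZero f) (hg : IsGammaZero g)
    (hφ : IsGammaZero (infPostcomp L f)) (hψ : IsGammaZero (infPostcomp (-K) g))
    (hLf : IsExactPostcomp L f) (hKg : IsExactPostcomp (-K) g) {r w : U}
    (h1 : w ∈ subdiff (infPostcomp L f) r) (h2 : -w ∈ subdiff (infPostcomp (-K) g) (r - c)) :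
    IsDualSol f g L K c (-w) := by
  obtain ⟨x, hx, hxs⟩ := hφ.exists_adjoint_mem_subdiff hLf h1
  obtain ⟨y, hy, hys⟩ := hψ.exists_adjoint_mem_subdiff hKg h2
  have hK' : (-K).adjoint = -K.adjoint := map_neg _ _
  rw [hK', neg_apply, map_neg, neg_neg] at hys
  obtain ⟨a, ha⟩ := hf.exists_coe_of_mem_subdiff hxs
  obtain ⟨b, hb⟩ := hg.exists_coe_of_mem_subdiff hys
  have hval : ∀ u : U, ⟪-(L.adjoint u), x⟫_ℝ - a + (⟪-(K.adjoint u), y⟫_ℝ - b) + ⟪u, c⟫_ℝ =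
      -(a + b) := by
    intro u
    have hc : c = L x + K y := by
      rw [neg_apply] at hy
      rw [← neg_neg (K y), hy, hx]; abel
    rw [inner_neg_left, inner_neg_left, ContinuousLinearMap.adjoint_inner_left,
      ContinuousLinearMap.adjoint_inner_left, hc, inner_add_right]
    ring
  intro u
  simp only [map_neg, neg_neg]
  calc _ ≤ (((⟪L.adjoint w, x⟫_ℝ - a : ℝ) : EReal) + ((⟪K.adjoint w, y⟫_ℝ - b : ℝ) : EReal))
          + ((⟪-w, c⟫_ℝ : ℝ) : EReal) := by
        gcongr
        · exact fenchelConj_le_of_mem_subdiff hf ha hxs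
        · exact fenchelConj_le_of_mem_subdiff hg hb hys
    _ = ((-(a + b) : ℝ) : EReal) := by
        have := hval (-w)
        simp only [map_neg, neg_neg] at this
        exact_mod_cast this
    _ = (((⟪-(L.adjoint u), x⟫_ℝ - a : ℝ) : EReal) + ((⟪-(K.adjoint u), y⟫_ℝ - b : ℝ) : EReal))
          + ((⟪u, c⟫_ℝ : ℝ) : EReal) := by
        exact_mod_cast (hval u).symm
    _ ≤ _ := by
        gcongr
        · exact le_fenchelConj ha _
        · exact le_fenchelConj hb _

theorem isPrimalSol_of_adjoint_mem_subdiff (hf : IsGammaZero f) (hg : IsGammaZero g) {x : X}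
    {y : Y} {w : U} (hxy : L x + K y = c) (hx : L.adjoint w ∈ subdiff f x)
    (hy : (-K).adjoint (-w) ∈ subdiff g y) : IsPrimalSol f g L K c x y := by
  refine ⟨hxy, fun x' y' hxy' => ?_⟩
  obtain ⟨a, ha⟩ := hf.exists_coe_of_mem_subdiff hx
  obtain ⟨b, hb⟩ := hg.exists_coe_of_mem_subdiff hy
  rw [mem_subdiff_adjoint_iff] at hx hy
  refine le_trans (le_of_eq ?_) (add_le_add (hx x') (hy y'))
  have : (-K) y' - (-K) y = L x' - L x := by
    simp only [neg_apply]
    rw [sub_eq_sub_iff_add_eq_add, ← sub_eq_zero]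
    have := sub_eq_zero.2 (hxy.trans hxy'.symm)
    rw [← this]; abel
  rw [ha, hb, this, inner_neg_right]
  norm_cast
  ring

/-- Convergence of the iterates in finite dimension. -/
theorem IsDouglasRachford.exists_tendsto [FiniteDimensional ℝ X] [FiniteDimensional ℝ Y]
    [FiniteDimensional ℝ U] (hf : IsGammaZero f) (hg : IsGammaZero g)
    (hφ : IsGammaZero (infPostcomp L f)) (hψ : IsGammaZero (infPostcomp (-K) g))
    (hsol : ∃ (x : X) (y : Y) (u : U), IsPrimalDualSol f g L K c x y u)
    (hτ : 0 < τ) (hρ : ∀ i, ρ i ∈ Set.Icc (0 : ℝ) 2)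
    (hρ_sum : Tendsto (fun n => ∑ i ∈ Finset.range n, ρ i * (2 - ρ i)) atTop atTop)
    (hf_ne : ∀ r : U, (argminSet fun x : X =>
        (τ : EReal) * f x + ((1 / 2 * ‖L x - r‖ ^ 2 : ℝ) : EReal)).Nonempty)
    (hf_uniq : ∀ r : U, (argminSet fun x : X =>
        (τ : EReal) * f x + ((1 / 2 * ‖L x - r‖ ^ 2 : ℝ) : EReal)).Subsingleton)
    (hg_ne : ∀ r : U, (argminSet fun y : Y =>
        (τ : EReal) * g y + ((1 / 2 * ‖(-K) y - r‖ ^ 2 : ℝ) : EReal)).Nonempty)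
    (hg_uniq : ∀ r : U, (argminSet fun y : Y =>
        (τ : EReal) * g y + ((1 / 2 * ‖(-K) y - r‖ ^ 2 : ℝ) : EReal)).Subsingleton)
    {s : ℕ → U} (h : IsDouglasRachford f g L K c τ ρ xh y s) :
    ∃ (x' : X) (y' : Y), IsPrimalSol f g L K c x' y' ∧
      Tendsto (fun i => (xh i, y i)) atTop (𝓝 (x', y')) := by
  obtain ⟨r, w, -, -, h3, h4, h5, -⟩ :=
    h.exists_weaklyTendsto hf hg hφ hψ hsol hτ hρ hρ_sum
  have h3 := h3.tendsto
  have h4 := h4.tendsto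
  have h5 := h5.tendsto
  -- The limits are the minimizers of the subproblems at the limiting data.
  obtain ⟨x', hx'⟩ := hf_ne (r + τ • w)
  obtain ⟨y', hy'⟩ := hg_ne ((2 : ℝ) • r - (r + τ • w) - c)
  have hxlim : Tendsto xh atTop (𝓝 x') :=
    hf.tendsto_of_mem_argminSet hτ h.x_step hx' (hf_uniq _) h5 h3
  have hKy : Tendsto (fun i => (-K) (y (i + 1))) atTop (𝓝 (r - c)) := by
    have := ((tendsto_add_atTop_iff_nat (f := fun i => -K (y i) + c) 1).2 h4).sub_const c
    simpa using this
  have hylim : Tendsto y atTop (𝓝 y') :=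
    (tendsto_add_atTop_iff_nat 1).1 (hg.tendsto_of_mem_argminSet hτ h.mem_argminSet hy'
      (hg_uniq _) (((h3.const_smul (2 : ℝ)).sub h5).sub_const c) hKy)
  have hLx : L x' = r := tendsto_nhds_unique ((L.continuous.tendsto _).comp hxlim) h3
  have hKy' : -K y' + c = r :=
    tendsto_nhds_unique ((((K.continuous.tendsto _).comp hylim).neg).add_const c) h4
  refine ⟨x', y', ?_, hxlim.prodMk_nhds hylim⟩
  have h6 := hf.adjoint_mem_subdiff hτ hx'
  have h7 := hg.adjoint_mem_subdiff hτ hy'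
  rw [hLx, add_sub_cancel_left, inv_smul_smul₀ hτ.ne'] at h6
  have h8 : (2 : ℝ) • r - (r + τ • w) - c - (-K) y' = τ • (-w) := by
    rw [neg_apply, eq_sub_of_add_eq hKy']; module
  rw [h8, inv_smul_smul₀ hτ.ne'] at h7
  refine isPrimalSol_of_adjoint_mem_subdiff hf hg ?_ h6 h7
  rw [hLx, ← hKy']; abel

end ADMM

/-! ### Assembly of the theorem. -/

theorem theorem4p7
    {X Y U : Type*}
    [NormedAddCommGroup X] [InnerProductSpace ℝ X] [CompleteSpace X]
    [NormedAddCommGroup Y] [InnerProductSpace ℝ Y] [CompleteSpace Y]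
    [NormedAddCommGroup U] [InnerProductSpace ℝ U] [CompleteSpace U]
    (f : X → EReal) (hf : IsGammaZero f) (g : Y → EReal) (hg : IsGammaZero g)
    (L : X →L[ℝ] U) (hL : L ≠ 0) (K : Y →L[ℝ] U) (hK : K ≠ 0) (c : U)
    -- the primal-dual inclusion has a solution
    (hsol : ∃ (x : X) (y : Y) (u : U), IsPrimalDualSol f g L K c x y u)
    -- the infimal postcompositions are exact and lower semicontinuous
    (hLf : IsExactPostcomp L f) (hKg : IsExactPostcomp (-K) g)
    (hLf_lsc : LowerSemicontinuous (infPostcomp L f))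
    (hKg_lsc : LowerSemicontinuous (infPostcomp (-K) g))
    -- parameters and initialization
    (τ : ℝ) (hτ : 0 < τ) (ρ : ℕ → ℝ) (hρ : ∀ i, ρ i ∈ Set.Icc (0 : ℝ) 2)
    (hρ_sum : Tendsto (fun n => ∑ i ∈ Finset.range n, ρ i * (2 - ρ i)) atTop atTop)
    (y₀ : Y) (v₀ s₀ : U) (hs₀ : s₀ = -K y₀ + c - v₀) :
    -- all subproblems have minimizers, so that the iterations can be carried out
    ((∀ r : U, (argminSet fun x : X =>
        (τ : EReal) * f x + ((1 / 2 * ‖L x - r‖ ^ 2 : ℝ) : EReal)).Nonempty) ∧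
      (∀ r : U, (argminSet fun y : Y =>
        (τ : EReal) * g y + ((1 / 2 * ‖K y + r‖ ^ 2 : ℝ) : EReal)).Nonempty)) ∧
    -- the two iterations generate the same sequences `x^(i+1/2)`, `y^(i)`
    (∀ (xh : ℕ → X) (y : ℕ → Y), y 0 = y₀ →
      ((∃ v vh : ℕ → U, v 0 = v₀ ∧ IsADMM f g L K c τ ρ xh y v vh) ↔
        (∃ s : ℕ → U, s 0 = s₀ ∧ IsDouglasRachford f g L K c τ ρ xh y s))) ∧
    -- convergence of the ADMM
    (∀ (xh : ℕ → X) (y : ℕ → Y) (v vh : ℕ → U), y 0 = y₀ → v 0 = v₀ →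
      IsADMM f g L K c τ ρ xh y v vh →
      (∃ r : U, IsPostcompSol f g L K c r ∧
        WeaklyTendsto (fun i => L (xh i)) r ∧
        WeaklyTendsto (fun i => -K (y i) + c) r) ∧
      (∃ u : U, IsDualSol f g L K c u ∧
        WeaklyTendsto (fun i => τ⁻¹ • vh i) u ∧
        WeaklyTendsto (fun i => τ⁻¹ • v i) u) ∧
      Tendsto (fun i => L (xh i) + K (y (i + 1)) - c) atTop (𝓝 0)) ∧
    -- convergence of the Douglas-Rachford algorithm
    (∀ (xh : ℕ → X) (y : ℕ → Y) (s : ℕ → U), y 0 = y₀ → s 0 = s₀ →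
      IsDouglasRachford f g L K c τ ρ xh y s →
      (∃ r : U, IsPostcompSol f g L K c r ∧
        WeaklyTendsto (fun i => L (xh i)) r ∧
        WeaklyTendsto (fun i => -K (y i) + c) r) ∧
      Tendsto (fun i => L (xh i) + K (y (i + 1)) - c) atTop (𝓝 0)) ∧
    -- finite dimension and unique minimizers: convergence to a primal solution
    (FiniteDimensional ℝ X → FiniteDimensional ℝ Y → FiniteDimensional ℝ U →
      (∀ r : U, (argminSet fun x : X =>
        (τ : EReal) * f x + ((1 / 2 * ‖L x - r‖ ^ 2 : ℝ) : EReal)).Subsingleton) →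
      (∀ r : U, (argminSet fun y : Y =>
        (τ : EReal) * g y + ((1 / 2 * ‖K y + r‖ ^ 2 : ℝ) : EReal)).Subsingleton) →
      (∀ (xh : ℕ → X) (y : ℕ → Y) (v vh : ℕ → U), y 0 = y₀ → v 0 = v₀ →
        IsADMM f g L K c τ ρ xh y v vh →
        ∃ (x' : X) (y' : Y), IsPrimalSol f g L K c x' y' ∧
          Tendsto (fun i => (xh i, y i)) atTop (𝓝 (x', y'))) ∧
      (∀ (xh : ℕ → X) (y : ℕ → Y) (s : ℕ → U), y 0 = y₀ → s 0 = s₀ →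
        IsDouglasRachford f g L K c τ ρ xh y s →
        ∃ (x' : X) (y' : Y), IsPrimalSol f g L K c x' y' ∧
          Tendsto (fun i => (xh i, y i)) atTop (𝓝 (x', y')))) := by
  have hφ := hf.infPostcomp hLf hLf_lsc
  have hψ := hg.infPostcomp hKg hKg_lsc
  obtain ⟨x₁, y₁, u₁, h₁⟩ := id hsol
  have hf_ne := hf.exists_mem_argminSet hLf hLf_lsc hτ h₁.exists_mem_subdiff.1
  have hg_ne := hg.exists_mem_argminSet hKg hKg_lsc hτ h₁.exists_mem_subdiff.2
  refine ⟨⟨hf_ne, fun r => argminSet_norm_add_eq (K := K) r ▸ hg_ne r⟩, fun xh y hy₀ => ⟨?_, ?_⟩,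
    fun xh y v vh hy₀ hv₀ h => ?_, fun xh y s hy₀ hs₀' h => ?_,
    fun _ _ _ hf_uniq hg_uniq => ?_⟩
  · rintro ⟨v, vh, hv₀, h⟩
    exact ⟨_, by rw [hy₀, hv₀, hs₀], h.isDouglasRachford⟩
  · rintro ⟨s, hs, h⟩
    exact ⟨_, _, by rw [hy₀, hs, hs₀]; abel, h.isADMM⟩
  · obtain ⟨r, w, h1, h2, h3, h4, h5, h6⟩ :=
      h.isDouglasRachford.exists_weaklyTendsto hf hg hφ hψ hsol hτ hρ hρ_sum
    refine ⟨⟨r, isPostcompSol_of_mem_subdiff hφ hψ h1 h2, h3, h4⟩,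
      ⟨-w, isDualSol_of_mem_subdiff hf hg hφ hψ hLf hKg h1 h2, ?_, ?_⟩, h6⟩
    -- With `s = -K y + c - v` one has `vh = L xh - s` and `v = (-K y + c) - s`; both tend weakly to
    -- `r - (r + τ w) = -τ w`.
    · have h7 := (h3.sub h5).const_smul τ⁻¹
      rw [sub_add_cancel_left, ← smul_neg, inv_smul_smul₀ hτ.ne'] at h7
      convert h7 using 3 with i
      rw [h.v_half_step]
      abel
    · have h7 := (h4.sub h5).const_smul τ⁻¹
      rw [sub_add_cancel_left, ← smul_neg, inv_smul_smul₀ hτ.ne'] at h7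
      simpa only [sub_sub_cancel] using h7
  · obtain ⟨r, w, h1, h2, h3, h4, -, h6⟩ :=
      h.exists_weaklyTendsto hf hg hφ hψ hsol hτ hρ hρ_sum
    exact ⟨⟨r, isPostcompSol_of_mem_subdiff hφ hψ h1 h2, h3, h4⟩, h6⟩
  · have hg_uniq' := fun r => argminSet_norm_add_eq (τ := τ) (g := g) (K := K) r ▸ hg_uniq r
    exact ⟨fun xh y v vh _ _ h => h.isDouglasRachford.exists_tendsto hf hg hφ hψ hsol hτ hρ hρ_sum
        hf_ne hf_uniq hg_ne hg_uniq',
      fun xh y s _ _ h => h.exists_tendsto hf hg hφ hψ hsol hτ hρ hρ_sum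
        hf_ne hf_uniq hg_ne hg_uniq'⟩
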